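/- For a finite family $x=(x_1,\dots,x_n)$ of points of $\mathbb{R}^d$ (repetitions allowed and counted with multiplicity) and $q\in\mathbb{R}^d$, let the Tukey depth $\tau_x(q)$ be $\frac1n$ times the minimum, over all closed halfspaces $H\ni q$, of the number of indices $i$ with $x_i\in H$. **Theorem (Depth Helly's theorem).** There are constants $c(d,t)$, depending only on the integer $d\ge 1$ and on $t\in[0,1]$, with $c(d,0)=0$ and $c(d,t)>0$ for $t>0$, such that both of the following hold. (a) (They are constants for the Depth Carathéodory theorem.) Let $x$ be a family of $n\ge d+1$ points of $\mathbb{R}^d$ and let $q\in\mathbb{R}^d$ have Tukey depth $\tau=\tau_x(q)>0$. Then there are pairwise disjoint index sets $X_1,\dots,X_{d+1}\subseteq\{1,\dots,n\}$, each with at least $c(d,\tau)\,n$ elements, such that $q\in\operatorname{Conv}\{x_{i_1},\dots,x_{i_{d+1}}\}$ for every choice of $i_j\in X_j$. (b) Let $0\le\beta\le1$ and $\alpha=c(d,1-\beta)$, and let $\mathcal F=\{C_1,\dots,C_n\}$ be a family of $n\ge d+1$ convex sets in $\mathbb{R}^d$. Suppose that for every choice of (not necessarily disjoint) nonempty subfamilies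 $F_1,\dots,F_{d+1}$ of $\mathcal F$, each with at least $\alpha n$ sets, there are sets $D_i\in F_i$ with $\bigcap_{i=1}^{d+1}D_i\ne\emptyset$. Then there is a subfamily $\mathcal F'\subseteq\mathcal F$ of at least $\beta n$ sets with $\bigcap\mathcal F'\neq\emptyset$ (the intersection of the empty subfamily being $\mathbb{R}^d$). -/

import Mathlib

/-- The points of the finite family `x` (indexed, so counted with multiplicity) that lie in the
closed halfspace `{y | ⟪u, y⟫ ≤ a}`, as a set of indices. -/
noncomputable def pointsInHalfspace {d n : ℕ} (x : Fin n → EuclideanSpace ℝ (Fin d))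
    (u : EuclideanSpace ℝ (Fin d)) (a : ℝ) : Finset (Fin n) :=
  by classical exact Finset.univ.filter fun i => inner ℝ u (x i) ≤ a

/-- The minimum number of points of `x` in a closed halfspace of `ℝ^d` that contains `q`.
For `1 ≤ d` the set of numbers below is nonempty, so the infimum is a minimum. -/
noncomputable def tukeyCount {d n : ℕ} (x : Fin n → EuclideanSpace ℝ (Fin d))
    (q : EuclideanSpace ℝ (Fin d)) : ℕ :=
  sInf {k : ℕ | ∃ (u : EuclideanSpace ℝ (Fin d)) (a : ℝ),
    u ≠ 0 ∧ inner ℝ u q ≤ a ∧ k = (pointsInHalfspace x u a).card}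

/-- The (normalized) Tukey depth of `q` with respect to the family `x` of `n` points. -/
noncomputable def tukeyDepth {d n : ℕ} (x : Fin n → EuclideanSpace ℝ (Fin d))
    (q : EuclideanSpace ℝ (Fin d)) : ℝ :=
  (tukeyCount x q : ℝ) / n

/-- `c` is an admissible constant, as a function of the Tukey depth, in the depth version of
Carathéodory's theorem in `ℝ^d`: it is positive at positive depths, and whenever `q` has positive
depth `τ` with respect to `n ≥ d + 1` points, there are `d + 1` pairwise disjoint subfamilies,
each of at least `c τ * n` points, such that `q` is in the convex hull of every choice of one
point from each of them. -/
def IsDepthCaratheodoryConstant (d : ℕ) (c : ℝ → ℝ) : Prop :=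
  (∀ t : ℝ, 0 < t → t ≤ 1 → 0 < c t) ∧
  ∀ (n : ℕ) (x : Fin n → EuclideanSpace ℝ (Fin d)) (q : EuclideanSpace ℝ (Fin d)),
    d + 1 ≤ n → 0 < tukeyDepth x q →
    ∃ X : Fin (d + 1) → Finset (Fin n),
      (∀ i j, i ≠ j → Disjoint (X i) (X j)) ∧
      (∀ i, c (tukeyDepth x q) * n ≤ ((X i).card : ℝ)) ∧
      ∀ y : Fin (d + 1) → Fin n, (∀ i, y i ∈ X i) →
        q ∈ convexHull ℝ (Set.range fun i => x (y i))

/-!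
The constants come from a depth version of Carathéodory's theorem
(`exists_transversals_of_depth`): if every closed halfspace with `0` on its boundary contains at
least `τ N` of at most `N` vectors, then there are at most `dim E + 1` disjoint subfamilies of
proportional size all of whose transversals have `0` in their convex hull.

For its proof, induct on the dimension. If the vectors on some hyperplane through `0` already have
`0` at depth `τ / 2` inside the hyperplane, use the induction hypothesis there. Otherwise `0` is
deep for open halfspaces, a condition stable under small perturbations, so the vectors may be
taken in general position. Colour them so that a hyperplane through `0` crosses only a small share
of the colour classes, counted with their masses (`exists_coloring_crossMass_le_pow`): every open
halfspace then contains a whole large class, so every transversal of the large classes has `0` in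
its convex hull. Shrink the classes until the hulls of any `dim E` of them contain only linearly
independent transversals (`exists_independentHulls`). By Carathéodory's theorem one transversal of
`dim E + 1` classes has `0` in its convex hull, and by independence this survives the replacement
of its vectors one at a time (`zero_mem_convexHull_of_transversal`).

For the Helly part, suppose that every point is missed by many of the sets, which may be assumed
to be polytopes. The KKM theorem, applied to the sets of points from which a move to `y` does not
get closer to many of the sets, gives a point `p` such that every move away from `p` fails to get
closer to many of the sets that miss `p` (`exists_deep_point`). So `0` is deep for the vectors
from `p` to the nearest points of the sets, and the depth version of Carathéodory's theorem gives
large subfamilies. A transversal of these with a common point `z` is impossible: the vectors from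
`p` to the nearest points would all make an acute angle with `z - p`, although `0` is in their
convex hull. When all the sets are required to meet, this is Helly's theorem.

The KKM theorem is proved with a Sperner lemma for the simplicial grid on integer points. The sum
over all cells of the determinant of the vertices times the determinant of their images does not
change when a map that preserves the faces is changed at a vertex (`detSum_eq`), because the
contributions of neighbouring cells cancel. For the identity it is positive, so some cell carries
all the labels.
-/

/-! ### Cyclic cells of the simplicial grid -/

/-- The step `e_{i+1} - e_i`, with cyclic indices. The `k + 2` steps add up to zero. -/
def cyclicStep {k : ℕ} (i : Fin (k + 2)) : Fin (k + 2) → ℤ :=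
  Pi.single (i + 1) 1 - Pi.single i 1

/-- The vertices of a simplex of the (Kuhn--Freudenthal) triangulation of the lattice of integer
points with a given coordinate sum, in cyclic order: a closed walk that uses every cyclic step
exactly once. Each simplex is listed once for each of its vertices as starting point. -/
def IsCell {k : ℕ} (s : Fin (k + 2) → Fin (k + 2) → ℤ) : Prop :=
  ∃ π : Equiv.Perm (Fin (k + 2)), ∀ j, s (j + 1) = s j + cyclicStep (π j)

/-- The cell on the other side of the facet opposite to the vertex `s j`. -/
def pivot {k : ℕ} (s : Fin (k + 2) → Fin (k + 2) → ℤ) (j : Fin (k + 2)) :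
    Fin (k + 2) → Fin (k + 2) → ℤ :=
  Function.update s j (s (j - 1) + s (j + 1) - s j)

section Cells

open scoped Fin.NatCast Fin.CommRing

variable {k : ℕ} {s : Fin (k + 2) → Fin (k + 2) → ℤ}

theorem sub_one_ne (j : Fin (k + 2)) : j - 1 ≠ j := by
  intro h
  have := sub_eq_self.1 h
  exact one_ne_zero this

theorem add_one_ne (j : Fin (k + 2)) : j + 1 ≠ j := by
  intro h
  have := add_eq_left.1 h
  exact one_ne_zero this

theorem pivot_pivot (s : Fin (k + 2) → Fin (k + 2) → ℤ) (j : Fin (k + 2)) :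
    pivot (pivot s j) j = s := by
  unfold pivot
  rw [Function.update_of_ne (sub_one_ne j), Function.update_of_ne (add_one_ne j),
    Function.update_self, Function.update_idem, sub_sub_cancel, Function.update_eq_self]

theorem IsCell.pivot (hs : IsCell s) (j : Fin (k + 2)) : IsCell (pivot s j) := by
  obtain ⟨π, hπ⟩ := hs
  refine ⟨(Equiv.swap (j - 1) j).trans π, fun a => ?_⟩
  have h1 := hπ (j - 1)
  rw [sub_add_cancel] at h1
  have h2 := hπ j
  have hv : s (j - 1) + s (j + 1) - s j = s (j - 1) + cyclicStep (π j) := by rw [h2]; abel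
  unfold _root_.pivot
  rw [hv, Equiv.trans_apply]
  by_cases ha : a = j
  · subst ha
    rw [Function.update_of_ne (add_one_ne a), Function.update_self, Equiv.swap_apply_right, h2, h1]
    abel
  · by_cases hb : a = j - 1
    · subst hb
      rw [sub_add_cancel, Function.update_self, Function.update_of_ne (sub_one_ne j),
        Equiv.swap_apply_left]
    · have hc : a + 1 ≠ j := fun h => hb (by rw [← h, add_sub_cancel_right])
      rw [Function.update_of_ne hc, Function.update_of_ne ha,
        Equiv.swap_apply_of_ne_of_ne hb ha, hπ a]

theorem IsCell.apply_add (π : Equiv.Perm (Fin (k + 2)))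
    (hπ : ∀ j, s (j + 1) = s j + cyclicStep (π j)) (j : Fin (k + 2)) (t : ℕ) :
    s (j + (t : Fin (k + 2))) =
      s j + ∑ l ∈ Finset.range t, cyclicStep (π (j + (l : Fin (k + 2)))) := by
  induction t with
  | zero => simp
  | succ t ih =>
    rw [Finset.sum_range_succ, ← add_assoc, ← ih, Nat.cast_succ, ← add_assoc, hπ]

/-- Between two vertices of a cell, each coordinate goes up at most once. -/
theorem IsCell.apply_le (hs : IsCell s) (a b i : Fin (k + 2)) : s a i ≤ s b i + 1 := by
  obtain ⟨π, hπ⟩ := hs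
  have h := IsCell.apply_add π hπ b (a - b).val
  rw [Fin.cast_val_eq_self, add_sub_cancel] at h
  rw [h, Pi.add_apply, Finset.sum_apply]
  refine add_le_add_right ?_ _
  calc ∑ l ∈ Finset.range (a - b).val, cyclicStep (π (b + (l : Fin (k + 2)))) i
      ≤ ∑ l ∈ Finset.range (a - b).val, if i = π (b + (l : Fin (k + 2))) + 1 then (1 : ℤ) else 0 := by
        refine Finset.sum_le_sum fun l _ => ?_
        simp only [cyclicStep, Pi.sub_apply, Pi.single_apply]
        split_ifs <;> simp
    _ ≤ 1 := by
        rw [Finset.sum_boole]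
        norm_cast
        refine Finset.card_le_one.2 fun l hl m hm => ?_
        simp only [Finset.mem_filter, Finset.mem_range] at hl hm
        have h1 := add_right_cancel (hl.2.symm.trans hm.2)
        have h2 := add_left_cancel (π.injective h1)
        have hlt := (a - b).isLt
        have h3 := congrArg Fin.val h2
        rwa [Fin.val_natCast, Fin.val_natCast, Nat.mod_eq_of_lt (by omega),
          Nat.mod_eq_of_lt (by omega)] at h3

theorem sum_cyclicStep (i : Fin (k + 2)) : ∑ j, cyclicStep i j = 0 := by
  simp [cyclicStep]

theorem IsCell.sum_eq (hs : IsCell s) (a b : Fin (k + 2)) : ∑ i, s a i = ∑ i, s b i := by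
  obtain ⟨π, hπ⟩ := hs
  have h := IsCell.apply_add π hπ b (a - b).val
  rw [Fin.cast_val_eq_self, add_sub_cancel] at h
  simp only [h, Pi.add_apply, Finset.sum_apply, Finset.sum_add_distrib]
  rw [Finset.sum_comm]
  simp [sum_cyclicStep]

/-- The integer points of the dilated standard simplex. -/
noncomputable def simplexGrid (k N : ℕ) : Finset (Fin (k + 2) → ℤ) :=
  (Fintype.piFinset fun _ => Finset.Icc 0 (N : ℤ)).filter fun v => ∑ i, v i = N

theorem mem_simplexGrid {N : ℕ} {v : Fin (k + 2) → ℤ} :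
    v ∈ simplexGrid k N ↔ (∀ i, 0 ≤ v i) ∧ ∑ i, v i = N := by
  simp only [simplexGrid, Finset.mem_filter, Fintype.mem_piFinset, Finset.mem_Icc]
  constructor
  · rintro ⟨h, h'⟩
    exact ⟨fun i => (h i).1, h'⟩
  · rintro ⟨h, h'⟩
    exact ⟨fun i => ⟨h i, h' ▸ Finset.single_le_sum (fun j _ => h j) (Finset.mem_univ i)⟩, h'⟩

open Classical in
/-- The cells all of whose vertices lie in the dilated standard simplex. -/
noncomputable def gridCells (k N : ℕ) : Finset (Fin (k + 2) → Fin (k + 2) → ℤ) :=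
  (Fintype.piFinset fun _ => simplexGrid k N).filter IsCell

theorem mem_gridCells {N : ℕ} : s ∈ gridCells k N ↔ (∀ j, s j ∈ simplexGrid k N) ∧ IsCell s := by
  simp [gridCells]

/-! ### The determinant sum -/

/-- Up to a constant, the signed volume of the image of the cell `s` under the map that is `f` at
the vertices and affine on the cell. -/
noncomputable def cellDet (f : (Fin (k + 2) → ℤ) → Fin (k + 2) → ℝ)
    (s : Fin (k + 2) → Fin (k + 2) → ℤ) : ℝ :=
  Matrix.det (Matrix.of fun j => f (s j))

/-- The inclusion of the integer points into the real ones. -/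
def intPoint (v : Fin (k + 2) → ℤ) : Fin (k + 2) → ℝ := fun i => v i

/-- The signed volumes of the images under `f` of all cells of the grid; the factor
`cellDet intPoint s` carries the orientation of the cell. -/
noncomputable def detSum (N : ℕ) (f : (Fin (k + 2) → ℤ) → Fin (k + 2) → ℝ) : ℝ :=
  ∑ s ∈ gridCells k N, cellDet intPoint s * cellDet f s

/-- Maps from the grid to the hyperplane of the standard simplex that send each vertex to the
affine hull of the smallest face that contains it. -/
def FacePreserving (N : ℕ) (f : (Fin (k + 2) → ℤ) → Fin (k + 2) → ℝ) : Prop :=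
  ∀ v ∈ simplexGrid k N, ∑ i, f v i = 1 ∧ ∀ i, v i = 0 → f v i = 0

theorem cellDet_pivot (s : Fin (k + 2) → Fin (k + 2) → ℤ) (j : Fin (k + 2)) :
    cellDet intPoint (pivot s j) = - cellDet intPoint s := by
  unfold cellDet
  set M : Matrix (Fin (k + 2)) (Fin (k + 2)) ℝ := Matrix.of fun j => intPoint (s j) with hM
  have h : (Matrix.of fun a => intPoint (pivot s j a)) =
      M.updateRow j (M (j - 1) + (M (j + 1) + (-1 : ℝ) • M j)) := by
    ext a i
    by_cases ha : a = j
    · subst ha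
      simp [pivot, hM, intPoint]
      ring
    · simp [pivot, hM, ha, intPoint]
  rw [h, Matrix.det_updateRow_add, Matrix.det_updateRow_add, Matrix.det_updateRow_smul,
    Matrix.updateRow_eq_self, Matrix.det_updateRow_eq_zero (sub_one_ne j),
    Matrix.det_updateRow_eq_zero (add_one_ne j)]
  ring

/-- A determinant with one row of coordinate sum `0` and the others of coordinate sum `1` is the
sum of the determinants obtained by putting a basis vector into each of the other rows. -/
theorem det_eq_sum_updateRow (M : Matrix (Fin (k + 2)) (Fin (k + 2)) ℝ) (j i₀ : Fin (k + 2))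
    (hj : ∑ i, M j i = 0) (hM : ∀ a, a ≠ j → ∑ i, M a i = 1) :
    M.det = ∑ a ∈ Finset.univ.erase j, (M.updateRow a (Pi.single i₀ 1)).det := by
  have h := Matrix.mulVec_cramer M.transpose (Pi.single i₀ 1)
  have h1 := congrArg (fun v : Fin (k + 2) → ℝ => ∑ i, v i) h
  simp only [Matrix.mulVec, dotProduct, Matrix.transpose_apply, Matrix.det_transpose,
    Pi.smul_apply, smul_eq_mul, ← Finset.mul_sum, 
    Matrix.cramer_transpose_apply] at h1
  rw [Finset.sum_comm] at h1
  simp only [← Finset.sum_mul] at h1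
  rw [← Finset.add_sum_erase _ _ (Finset.mem_univ j), hj, zero_mul, zero_add] at h1
  have h2 : ∑ i, (Pi.single i₀ (1 : ℝ) : Fin (k + 2) → ℝ) i = 1 := by simp
  rw [h2, mul_one] at h1
  rw [← h1]
  refine Finset.sum_congr rfl fun a ha => ?_
  rw [hM a (Finset.ne_of_mem_erase ha), one_mul]

/-- The cancellation behind the invariance of the determinant sum: the terms of two cells with a
common facet cancel, and the terms of a facet on the boundary vanish. -/
theorem sum_cell_facet_eq_zero {N : ℕ} {f : (Fin (k + 2) → ℤ) → Fin (k + 2) → ℝ}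
    (hf : FacePreserving N f) {v : Fin (k + 2) → ℤ} (e : Fin (k + 2) → ℝ)
    (he : ∀ i, v i = 0 → e i = 0) {i₀ : Fin (k + 2)} (hi₀ : v i₀ ≠ 0) {j a : Fin (k + 2)}
    (ha : a ≠ j) :
    ∑ s ∈ gridCells k N with s j = v, cellDet intPoint s *
      (((Matrix.of fun b => f (s b)).updateRow j e).updateRow a (Pi.single i₀ 1)).det = 0 := by
  have hdet : ∀ s : Fin (k + 2) → Fin (k + 2) → ℤ,
      ((Matrix.of fun b => f (pivot s a b)).updateRow j e).updateRow a (Pi.single i₀ 1) =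
      ((Matrix.of fun b => f (s b)).updateRow j e).updateRow a (Pi.single i₀ 1) := by
    intro s
    ext b i
    by_cases hb : b = a
    · subst hb; simp
    · simp [Matrix.updateRow_apply, hb, pivot]
  classical
  rw [← Finset.sum_filter_ne_zero]
  refine Finset.sum_involution (fun s _ => pivot s a) ?_ ?_ ?_ ?_
  · intro s _
    rw [hdet, cellDet_pivot]
    ring
  · intro s _ hne heq
    apply hne
    have := cellDet_pivot s a
    rw [heq] at this
    rw [show cellDet intPoint s = 0 by linarith, zero_mul]
  · intro s hs
    simp only [Finset.mem_filter, mem_gridCells] at hs ⊢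
    obtain ⟨⟨⟨hsN, hs⟩, hsj⟩, hne⟩ := hs
    have hother : ∀ b, b ≠ a → pivot s a b = s b := fun b hb => by simp [pivot, hb]
    refine ⟨⟨⟨?_, hs.pivot a⟩, by rw [hother j ha.symm, hsj]⟩, ?_⟩
    swap
    · rw [hdet, cellDet_pivot, neg_mul]
      exact neg_ne_zero.2 hne
    intro b
    rw [mem_simplexGrid]
    have hsum : ∑ i, pivot s a b i = N := by
      rw [(hs.pivot a).sum_eq b j, hother j ha.symm]
      exact (mem_simplexGrid.1 (hsN j)).2
    refine ⟨fun i => ?_, hsum⟩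
    by_cases hb : b = a
    swap
    · rw [hother b hb]
      exact (mem_simplexGrid.1 (hsN b)).1 i
    subst hb
    by_contra! hneg
    -- The facet lies in the face `i` of the simplex, so column `i` of the matrix vanishes.
    have hzero : ∀ c, c ≠ b → s c i = 0 := by
      intro c hc
      have h1 := (hs.pivot b).apply_le c b i
      rw [hother c hc] at h1
      have h2 := (mem_simplexGrid.1 (hsN c)).1 i
      omega
    have hvi : v i = 0 := by rw [← hsj]; exact hzero j ha.symm
    apply hne
    rw [Matrix.det_eq_zero_of_column_eq_zero i, mul_zero]
    intro c
    by_cases hc : c = b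
    · subst hc
      rw [Matrix.updateRow_self, Pi.single_apply, if_neg]
      rintro rfl
      exact hi₀ hvi
    · rw [Matrix.updateRow_ne hc]
      by_cases hcj : c = j
      · subst hcj
        rw [Matrix.updateRow_self]
        exact he i hvi
      · rw [Matrix.updateRow_ne hcj]
        exact (hf _ (hsN c)).2 i (hzero c hc)
  · intro s _
    exact pivot_pivot s a

theorem injective_of_cellDet_ne_zero {f : (Fin (k + 2) → ℤ) → Fin (k + 2) → ℝ}
    (h : cellDet f s ≠ 0) : Function.Injective fun j => f (s j) := by
  intro a b hab
  by_contra hne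
  exact h (Matrix.det_zero_of_row_eq hne hab)

/-- Moving the image of one vertex within its face does not change the determinant sum. -/
theorem detSum_eq_of_eq_off {N : ℕ} (hN : 0 < N) {f g : (Fin (k + 2) → ℤ) → Fin (k + 2) → ℝ}
    (hf : FacePreserving N f) (hg : FacePreserving N g) {v : Fin (k + 2) → ℤ}
    (hv : v ∈ simplexGrid k N) (hfg : ∀ u, u ≠ v → f u = g u) : detSum N f = detSum N g := by
  classical
  set e := f v - g v with he_def
  have he : ∀ i, v i = 0 → e i = 0 := fun i hi => by
    simp [he_def, (hf v hv).2 i hi, (hg v hv).2 i hi]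
  have hesum : ∑ i, e i = 0 := by
    simp [he_def, (hf v hv).1, (hg v hv).1]
  obtain ⟨i₀, hi₀⟩ : ∃ i₀, v i₀ ≠ 0 := by
    by_contra! h
    have := (mem_simplexGrid.1 hv).2
    simp [h] at this
    omega
  have hterm : ∀ s ∈ gridCells k N,
      cellDet intPoint s * cellDet f s - cellDet intPoint s * cellDet g s =
      ∑ j, ∑ a ∈ Finset.univ.erase j, if s j = v then cellDet intPoint s *
        (((Matrix.of fun b => f (s b)).updateRow j e).updateRow a (Pi.single i₀ 1)).det
        else 0 := by
    intro s hs
    rw [mem_gridCells] at hs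
    by_cases hW : cellDet intPoint s = 0
    · simp [hW]
    have hinj : Function.Injective s := by
      intro a b hab
      exact injective_of_cellDet_ne_zero hW (congrArg intPoint hab)
    by_cases hex : ∃ j, s j = v
    · obtain ⟨j, hj⟩ := hex
      have huniq : ∀ b, b ≠ j → s b ≠ v := fun b hb h => hb (hinj (h.trans hj.symm))
      rw [Finset.sum_eq_single j _ (by simp)]
      swap
      · intro b _ hb
        simp [huniq b hb]
      simp only [hj, if_true]
      rw [← Finset.mul_sum, ← mul_sub]
      congr 1
      set M : Matrix (Fin (k + 2)) (Fin (k + 2)) ℝ := Matrix.of fun b => f (s b) with hM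
      rw [← det_eq_sum_updateRow _ j i₀]
      · have h1 : cellDet f s = (M.updateRow j (e + g v)).det := by
          have : e + g v = M j := by
            rw [he_def, sub_add_cancel, ← hj]
            rfl
          rw [this, Matrix.updateRow_eq_self]
          rfl
        have h2 : cellDet g s = (M.updateRow j (g v)).det := by
          unfold cellDet
          congr 1
          ext b i
          by_cases hb : b = j
          · subst hb; simp [hj]
          · simp [hM, hb, hfg _ (huniq b hb)]
        rw [h1, h2, Matrix.det_updateRow_add]
        ring
      · simpa using hesum
      · intro a ha
        simp only [Matrix.updateRow_ne ha]
        exact (hf _ (hs.1 a)).1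
    · push Not at hex
      have : cellDet f s = cellDet g s := by
        unfold cellDet
        congr 1
        ext b i
        simp [hfg _ (hex b)]
      simp [this, hex]
  rw [← sub_eq_zero, detSum, detSum, ← Finset.sum_sub_distrib, Finset.sum_congr rfl hterm,
    Finset.sum_comm]
  refine Finset.sum_eq_zero fun j _ => ?_
  rw [Finset.sum_comm]
  refine Finset.sum_eq_zero fun a ha => ?_
  rw [← Finset.sum_filter]
  exact sum_cell_facet_eq_zero hf e he hi₀ (Finset.ne_of_mem_erase ha)

/-- The determinant sum is the same for all face preserving maps. -/
theorem detSum_eq {N : ℕ} (hN : 0 < N) {f g : (Fin (k + 2) → ℤ) → Fin (k + 2) → ℝ}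
    (hf : FacePreserving N f) (hg : FacePreserving N g) : detSum N f = detSum N g := by
  classical
  have key : ∀ D ⊆ simplexGrid k N, detSum N (fun v => if v ∈ D then g v else f v) = detSum N f := by
    intro D
    induction D using Finset.induction_on with
    | empty => simp
    | insert v D hvD ih =>
      intro hD
      rw [Finset.insert_subset_iff] at hD
      rw [← ih hD.2]
      refine detSum_eq_of_eq_off hN (v := v) ?_ ?_ hD.1 ?_
      · intro u hu
        by_cases h : u ∈ insert v D <;> simp only [h, if_true, if_false]
        exacts [hg u hu, hf u hu]
      · intro u hu
        by_cases h : u ∈ D <;> simp only [h, if_true, if_false]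
        exacts [hg u hu, hf u hu]
      · intro u hu
        simp [Finset.mem_insert, hu]
  rw [← key _ subset_rfl]
  refine Finset.sum_congr rfl fun s hs => ?_
  rw [mem_gridCells] at hs
  simp [cellDet, hs.1]

/-- The cell at the corner of the grid. -/
theorem exists_cellDet_ne_zero (k : ℕ) {N : ℕ} (hN : 0 < N) :
    ∃ s ∈ gridCells k N, cellDet intPoint s ≠ 0 := by
  refine ⟨fun j => Pi.single 0 ((N : ℤ) - 1) + Pi.single j 1, ?_, ?_⟩
  · rw [mem_gridCells]
    refine ⟨fun j => ?_, Equiv.refl _, fun j => ?_⟩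
    · rw [mem_simplexGrid]
      constructor
      · intro i
        simp only [Pi.add_apply, Pi.single_apply]
        split_ifs <;> omega
      · simp [Finset.sum_add_distrib]
    · simp only [cyclicStep, Equiv.refl_apply]
      abel
  · unfold cellDet
    rw [Matrix.det_of_isLowerTriangular]
    · refine Finset.prod_ne_zero_iff.2 fun j _ => ?_
      simp only [Matrix.of_apply, intPoint, Pi.add_apply, Pi.single_eq_same]
      by_cases hj : j = 0
      · subst hj
        simp only [Pi.single_eq_same, sub_add_cancel, Int.cast_natCast]
        positivity
      · simp [hj]
    · intro a b hab
      have hab' : a < b := hab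
      have hb : b ≠ 0 := (Fin.zero_le a).trans_lt hab' |>.ne'
      simp [intPoint, hb, hab'.ne']

/-- **Sperner's lemma** for the grid: if the label of every vertex is one of its nonzero
coordinates, then some cell carries all labels. -/
theorem exists_cell_bijective {N : ℕ} (hN : 0 < N) (l : (Fin (k + 2) → ℤ) → Fin (k + 2))
    (hl : ∀ v ∈ simplexGrid k N, v (l v) ≠ 0) :
    ∃ s ∈ gridCells k N, Function.Bijective fun j => l (s j) := by
  have hid : FacePreserving N fun v : Fin (k + 2) → ℤ => fun i => (N : ℝ)⁻¹ * (v i : ℝ) := by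
    intro v hv
    constructor
    · rw [← Finset.mul_sum]
      have h := (mem_simplexGrid.1 hv).2
      have h' : ∑ i, (v i : ℝ) = N := by exact_mod_cast h
      rw [h']
      exact inv_mul_cancel₀ (by positivity)
    · intro i hi
      simp [hi]
  have hlab : FacePreserving N fun v : Fin (k + 2) → ℤ => Pi.single (l v) (1 : ℝ) := by
    intro v hv
    constructor
    · simp
    · intro i hi
      refine Pi.single_eq_of_ne ?_ _
      rintro rfl
      exact hl v hv hi
  have hpos : 0 < detSum N fun v : Fin (k + 2) → ℤ => fun i => (N : ℝ)⁻¹ * (v i : ℝ) := by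
    have hc : ∀ s : Fin (k + 2) → Fin (k + 2) → ℤ,
        cellDet (fun v => fun i => (N : ℝ)⁻¹ * (v i : ℝ)) s =
          ((N : ℝ)⁻¹) ^ (k + 2) * cellDet intPoint s := by
      intro s
      have := Matrix.det_smul (Matrix.of fun j => intPoint (s j)) ((N : ℝ)⁻¹)
      rw [Fintype.card_fin] at this
      rw [cellDet, cellDet, ← this]
      rfl
    unfold detSum
    simp only [hc]
    obtain ⟨s, hs, hs0⟩ := exists_cellDet_ne_zero k hN
    refine Finset.sum_pos' (fun s _ => ?_) ⟨s, hs, ?_⟩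
    · have : 0 ≤ cellDet intPoint s * cellDet intPoint s := mul_self_nonneg _
      have h2 : (0 : ℝ) ≤ ((N : ℝ)⁻¹) ^ (k + 2) := by positivity
      nlinarith [mul_nonneg h2 this]
    · have : 0 < cellDet intPoint s * cellDet intPoint s := mul_self_pos.2 hs0
      have h2 : (0 : ℝ) < ((N : ℝ)⁻¹) ^ (k + 2) := by positivity
      nlinarith [mul_pos h2 this]
  rw [detSum_eq hN hid hlab] at hpos
  obtain ⟨s, hs, hs0⟩ := Finset.exists_ne_zero_of_sum_ne_zero hpos.ne'
  refine ⟨s, hs, Finite.injective_iff_bijective.1 fun a b hab => ?_⟩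
  exact injective_of_cellDet_ne_zero (right_ne_zero_of_mul hs0) (congrArg (Pi.single · (1 : ℝ)) hab)

end Cells

/-! ### The Knaster--Kuratowski--Mazurkiewicz theorem -/

/-- The **KKM theorem** on the standard simplex. -/
theorem exists_mem_stdSimplex_forall_mem {k : ℕ} (G : Fin (k + 2) → Set (Fin (k + 2) → ℝ))
    (hG : ∀ i, IsClosed (G i))
    (hcover : ∀ x ∈ stdSimplex ℝ (Fin (k + 2)), ∃ i, x i ≠ 0 ∧ x ∈ G i) :
    ∃ x ∈ stdSimplex ℝ (Fin (k + 2)), ∀ i, x ∈ G i := by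
  have hgrid : ∀ N : ℕ, ∃ P : Fin (k + 2) → Fin (k + 2) → ℝ,
      (∀ i, P i ∈ stdSimplex ℝ (Fin (k + 2)) ∧ P i ∈ G i) ∧
      ∀ i j, dist (P i) (P j) ≤ 1 / ((N : ℝ) + 1) := by
    intro N
    have hN : (0 : ℝ) < N + 1 := by positivity
    set pt : (Fin (k + 2) → ℤ) → Fin (k + 2) → ℝ := fun v i => (v i : ℝ) / (N + 1) with hpt
    have hmem : ∀ v ∈ simplexGrid k (N + 1), pt v ∈ stdSimplex ℝ (Fin (k + 2)) := by
      intro v hv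
      rw [mem_simplexGrid] at hv
      refine ⟨fun i => div_nonneg (by exact_mod_cast hv.1 i) hN.le, ?_⟩
      rw [hpt, ← Finset.sum_div, div_eq_one_iff_eq hN.ne']
      exact_mod_cast hv.2
    have hlab : ∀ v : Fin (k + 2) → ℤ, ∃ i, v ∈ simplexGrid k (N + 1) → v i ≠ 0 ∧ pt v ∈ G i := by
      intro v
      by_cases hv : v ∈ simplexGrid k (N + 1)
      · obtain ⟨i, hi, hi'⟩ := hcover _ (hmem v hv)
        refine ⟨i, fun _ => ⟨fun h => hi ?_, hi'⟩⟩
        simp [hpt, h]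
      · exact ⟨0, fun h => absurd h hv⟩
    choose l hl using hlab
    obtain ⟨s, hs, hbij⟩ := exists_cell_bijective N.succ_pos l fun v hv => (hl v hv).1
    rw [mem_gridCells] at hs
    choose c hc using hbij.surjective
    refine ⟨fun i => pt (s (c i)), fun i => ⟨hmem _ (hs.1 _), ?_⟩, fun i j => ?_⟩
    · have := (hl _ (hs.1 (c i))).2
      rwa [show l (s (c i)) = i from hc i] at this
    · refine (dist_pi_le_iff (by positivity)).2 fun a => ?_
      have h1 := hs.2.apply_le (c i) (c j) a
      have h2 := hs.2.apply_le (c j) (c i) a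
      rw [Real.dist_eq, hpt, ← sub_div, abs_div, abs_of_pos hN]
      gcongr
      rw [abs_le]
      constructor
      · have : (s (c j) a : ℝ) ≤ s (c i) a + 1 := by exact_mod_cast h2
        linarith
      · have : (s (c i) a : ℝ) ≤ s (c j) a + 1 := by exact_mod_cast h1
        linarith
  choose P hP hdist using hgrid
  obtain ⟨x, hx, φ, hφ, hlim⟩ := (isCompact_stdSimplex ℝ (Fin (k + 2))).tendsto_subseq
    fun N => (hP N 0).1
  refine ⟨x, hx, fun i => ?_⟩
  have hlim' : Filter.Tendsto (fun N => P (φ N) i) Filter.atTop (nhds x) := by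
    refine tendsto_of_tendsto_of_dist hlim ?_
    refine squeeze_zero (fun _ => dist_nonneg) (fun N => hdist (φ N) 0 i) ?_
    exact (tendsto_one_div_add_atTop_nhds_zero_nat (𝕜 := ℝ)).comp hφ.tendsto_atTop
  exact (hG i).mem_of_tendsto hlim' (Filter.Eventually.of_forall fun N => (hP (φ N) i).2)

/-- **Ky Fan's form of the KKM theorem**: closed sets `G y`, one of them compact, have a common
point if the convex hull of every finite set of points is covered by their sets. -/
theorem nonempty_iInter_of_convexHull_subset {E : Type*} [NormedAddCommGroup E] [NormedSpace ℝ E]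
    (G : E → Set E) (hG : ∀ y, IsClosed (G y)) (y₀ : E) (hy₀ : IsCompact (G y₀))
    (hcover : ∀ s : Finset E, ∀ p ∈ convexHull ℝ (s : Set E), ∃ y ∈ s, p ∈ G y) :
    (⋂ y, G y).Nonempty := by
  classical
  have hfin : ∀ u : Finset E, (⋂ y ∈ insert y₀ u, G y).Nonempty := by
    intro u
    set k := u.card with hk
    set g : Fin (k + 2) → E := fun i =>
      if h : (i : ℕ) < k then (u.equivFin.symm ⟨i, h⟩ : E) else y₀ with hg
    have hgu : ∀ y ∈ insert y₀ u, ∃ i, g i = y := by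
      intro y hy
      rcases Finset.mem_insert.1 hy with rfl | hy
      · exact ⟨⟨k, by omega⟩, by simp [hg]⟩
      · refine ⟨⟨u.equivFin ⟨y, hy⟩, by omega⟩, ?_⟩
        simp [hg, hk]
    set Φ : (Fin (k + 2) → ℝ) → E := fun t => ∑ i, t i • g i with hΦ
    have hΦc : Continuous Φ := by fun_prop
    obtain ⟨t, -, ht⟩ := exists_mem_stdSimplex_forall_mem (fun i => Φ ⁻¹' G (g i))
      (fun i => (hG _).preimage hΦc) (by
        intro t ht
        have hp : Φ t ∈ convexHull ℝ ((Finset.univ.filter fun i => t i ≠ 0).image g : Set E) := by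
          have h1 : Φ t = ∑ i with t i ≠ 0, t i • g i := by
            rw [hΦ, Finset.sum_filter_of_ne]
            intro i _ hi h0
            exact hi (by simp [h0])
          rw [h1]
          refine (convex_convexHull ℝ _).sum_mem (fun i _ => ht.1 i) ?_ fun i hi => ?_
          · rw [Finset.sum_filter_ne_zero]
            exact ht.2
          · exact subset_convexHull ℝ _ (by
              rw [Finset.mem_coe]
              exact Finset.mem_image_of_mem g hi)
        obtain ⟨y, hy, hpy⟩ := hcover _ _ hp
        obtain ⟨i, hi, rfl⟩ := Finset.mem_image.1 hy
        exact ⟨i, (Finset.mem_filter.1 hi).2, hpy⟩)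
    refine ⟨Φ t, Set.mem_iInter₂.2 fun y hy => ?_⟩
    obtain ⟨i, rfl⟩ := hgu y hy
    exact ht i
  have := hy₀.inter_iInter_nonempty G hG fun u => by
    have := hfin u
    rwa [Finset.set_biInter_insert] at this
  exact this.mono Set.inter_subset_right

/-! ### Convex combinations of finite families -/

section Combinations

variable {E ι : Type*} [AddCommGroup E] [Module ℝ E]

theorem mem_convexHull_image_iff {u : ι → E} {S : Finset ι} {p : E} :
    p ∈ convexHull ℝ (u '' S) ↔
      ∃ g : ι → ℝ, (∀ c ∈ S, 0 ≤ g c) ∧ ∑ c ∈ S, g c = 1 ∧ ∑ c ∈ S, g c • u c = p := by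
  classical
  constructor
  · intro hp
    rw [← Finset.coe_image, Finset.mem_convexHull'] at hp
    obtain ⟨w, hw, hw1, hwp⟩ := hp
    -- Give all the weight of a point to one chosen index.
    have hsel : ∀ y ∈ S.image u, ∃ c ∈ S, u c = y := fun y hy => Finset.mem_image.1 hy
    have hne : (S.image u).Nonempty := by
      by_contra h
      rw [Finset.not_nonempty_iff_eq_empty.1 h] at hw1
      simp at hw1
    have : Nonempty ι := (Finset.image_nonempty.1 hne).to_type
    choose! f hf huf using hsel
    have hinj : Set.InjOn f (S.image u : Set E) := fun a ha b hb hab => by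
      rw [← huf a ha, ← huf b hb, hab]
    have himg : (S.image u).image f ⊆ S := Finset.image_subset_iff.2 hf
    refine ⟨fun c => if c ∈ (S.image u).image f then w (u c) else 0, ?_, ?_, ?_⟩
    · intro c hc
      dsimp only
      split_ifs
      · exact hw _ (Finset.mem_image_of_mem u hc)
      · exact le_rfl
    · rw [Finset.sum_ite_mem, Finset.inter_eq_right.2 himg, Finset.sum_image hinj, ← hw1]
      exact Finset.sum_congr rfl fun y hy => by rw [huf y hy]
    · simp only [ite_smul, zero_smul]
      rw [Finset.sum_ite_mem, Finset.inter_eq_right.2 himg, Finset.sum_image hinj, ← hwp]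
      exact Finset.sum_congr rfl fun y hy => by rw [huf y hy]
  · rintro ⟨g, hg, hg1, rfl⟩
    exact (convex_convexHull ℝ _).sum_mem hg hg1 fun c hc =>
      subset_convexHull ℝ _ (Set.mem_image_of_mem u hc)

/-- **Carathéodory's theorem** for an indexed family. -/
theorem exists_subset_card_le_mem_convexHull [FiniteDimensional ℝ E] {u : ι → E} {A : Finset ι}
    {p : E} (hp : p ∈ convexHull ℝ (u '' A)) :
    ∃ S ⊆ A, S.card ≤ Module.finrank ℝ E + 1 ∧ p ∈ convexHull ℝ (u '' S) := by
  classical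
  obtain ⟨κ, _, z, w, hz, haff, hw, hw1, hwp⟩ := eq_pos_convex_span_of_mem_convexHull hp
  have hsel : ∀ c, ∃ i ∈ A, u i = z c := fun c => hz (Set.mem_range_self c)
  choose f hf huf using hsel
  refine ⟨Finset.univ.image f, Finset.image_subset_iff.2 fun c _ => hf c,
    Finset.card_image_le.trans ?_, ?_⟩
  · exact haff.card_le_finrank_succ.trans (Nat.succ_le_succ (Submodule.finrank_le _))
  rw [← hwp]
  refine (convex_convexHull ℝ _).sum_mem (fun c _ => (hw c).le) hw1 fun c _ => ?_
  exact subset_convexHull ℝ _ ⟨f c, by simp, huf c⟩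

/-- Let any `dim E` of `dim E + 1` convex sets be independent, in the sense that a choice of one
point from each is a linearly independent family. If `0` is a convex combination of one choice of
points from the `dim E + 1` sets, then also after one of the points is replaced. -/
theorem zero_mem_convexHull_update [DecidableEq ι] [FiniteDimensional ℝ E] {S : Finset ι}
    (hS : S.card = Module.finrank ℝ E + 1) {K : ι → Set E} (hK : ∀ c ∈ S, Convex ℝ (K c))
    (hind : ∀ a ∈ S, ∀ u : ι → E, (∀ c ∈ S, u c ∈ K c) → ∀ g : ι → ℝ,
      ∑ c ∈ S.erase a, g c • u c = 0 → ∀ c ∈ S.erase a, g c = 0)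
    {u : ι → E} (hu : ∀ c ∈ S, u c ∈ K c) (h0 : (0 : E) ∈ convexHull ℝ (u '' S))
    {k : ι} (hk : k ∈ S) {p : E} (hp : p ∈ K k) :
    (0 : E) ∈ convexHull ℝ (Function.update u k p '' S) := by
  -- A relation between the points of a choice with one vanishing coefficient is trivial.
  have hind' : ∀ v : ι → E, (∀ c ∈ S, v c ∈ K c) → ∀ g : ι → ℝ, ∑ c ∈ S, g c • v c = 0 →
      ∀ a ∈ S, g a = 0 → ∀ c ∈ S, g c = 0 := by
    intro v hv g hg a ha hga c hc
    by_cases hca : c = a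
    · rw [hca, hga]
    · refine hind a ha v hv g ?_ c (Finset.mem_erase.2 ⟨hca, hc⟩)
      rw [← Finset.add_sum_erase _ _ ha, hga, zero_smul, zero_add] at hg
      exact hg
  have hmem : ∀ q ∈ K k, ∀ c ∈ S, Function.update u k q c ∈ K c := by
    intro q hq c hc
    by_cases h : c = k
    · subst h; simpa using hq
    · simpa [h] using hu c hc
  have hsum : ∀ (g : ι → ℝ) (q : E), ∑ c ∈ S, g c • Function.update u k q c =
      g k • q + ∑ c ∈ S.erase k, g c • u c := by
    intro g q
    rw [← Finset.add_sum_erase _ _ hk, Function.update_self]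
    congr 1
    refine Finset.sum_congr rfl fun c hc => ?_
    rw [Function.update_of_ne (Finset.ne_of_mem_erase hc)]
  obtain ⟨l, hl, hl1, hl0⟩ := mem_convexHull_image_iff.1 h0
  have hlpos : ∀ a ∈ S, 0 < l a := by
    intro a ha
    refine (hl a ha).lt_of_ne fun h => ?_
    have := hind' u hu l hl0 a ha h.symm
    rw [Finset.sum_eq_zero this] at hl1
    exact zero_ne_one hl1
  obtain ⟨g, hg, hgk⟩ : ∃ g : ι → ℝ, ∑ c ∈ S, g c • Function.update u k p c = 0 ∧ 0 < g k := by
    have hdep : ¬ LinearIndependent ℝ fun c : S => Function.update u k p c := fun h => by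
      have := h.fintype_card_le_finrank
      rw [Fintype.card_coe, hS] at this
      omega
    obtain ⟨g₀, hg₀, c₀, hc₀⟩ := Fintype.not_linearIndependent_iff.1 hdep
    set g : ι → ℝ := fun c => if h : c ∈ S then g₀ ⟨c, h⟩ else 0 with hg_def
    have hg : ∑ c ∈ S, g c • Function.update u k p c = 0 := by
      rw [← Finset.sum_coe_sort, ← hg₀]
      exact Finset.sum_congr rfl fun c _ => by simp [hg_def]
    have hgk : g k ≠ 0 := by
      intro h
      have := hind' _ (hmem p hp) g hg k hk h c₀ c₀.2
      simp only [hg_def, c₀.2, dif_pos] at this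
      exact hc₀ this
    rcases hgk.lt_or_gt with h | h
    · refine ⟨-g, ?_, by simpa using h⟩
      simp only [Pi.neg_apply, neg_smul, Finset.sum_neg_distrib, hg, neg_zero]
    · exact ⟨g, hg, h⟩
  have hgnonneg : ∀ a ∈ S, 0 ≤ g a := by
    intro a ha
    by_contra! hga
    -- A point of the segment from `u k` to `p` would be in the span of the others without `u a`.
    have hak : a ≠ k := by rintro rfl; exact hga.not_gt hgk
    set α := l k * -g a with hα
    set β := l a * g k with hβ
    have hα0 : 0 < α := mul_pos (hlpos k hk) (neg_pos.2 hga)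
    have hβ0 : 0 < β := mul_pos (hlpos a ha) hgk
    set q := (α / (α + β)) • u k + (β / (α + β)) • p with hq
    have hqK : q ∈ K k := hK k hk (hu k hk) hp (by positivity) (by positivity)
      (by field_simp)
    have hrel : ∑ c ∈ S, (l a * g c - g a * l c) • Function.update u k q c = 0 := by
      rw [hsum, hq]
      rw [hsum] at hg
      rw [← Finset.add_sum_erase _ _ hk] at hl0
      have h1 : ∑ c ∈ S.erase k, (l a * g c - g a * l c) • u c =
          l a • ∑ c ∈ S.erase k, g c • u c - g a • ∑ c ∈ S.erase k, l c • u c := by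
        rw [Finset.smul_sum, Finset.smul_sum, ← Finset.sum_sub_distrib]
        exact Finset.sum_congr rfl fun c _ => by rw [sub_smul, mul_smul, mul_smul]
      rw [h1, eq_neg_of_add_eq_zero_right hg, eq_neg_of_add_eq_zero_right hl0]
      have h2 : l a * g k - g a * l k = α + β := by rw [hα, hβ]; ring
      rw [h2, smul_add, smul_smul, smul_smul, mul_div_cancel₀ _ (by positivity),
        mul_div_cancel₀ _ (by positivity), hα, hβ]
      module
    have := hind' _ (hmem q hqK) _ hrel a ha (by ring) k hk
    have h2 : l a * g k - g a * l k = α + β := by rw [hα, hβ]; ring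
    linarith
  have hpos : 0 < ∑ c ∈ S, g c := Finset.sum_pos' hgnonneg ⟨k, hk, hgk⟩
  refine mem_convexHull_image_iff.2 ⟨fun c => (∑ c ∈ S, g c)⁻¹ * g c, fun c hc => ?_, ?_, ?_⟩
  · exact mul_nonneg (inv_nonneg.2 hpos.le) (hgnonneg c hc)
  · rw [← Finset.mul_sum, inv_mul_cancel₀ hpos.ne']
  · simp only [mul_smul]
    rw [← Finset.smul_sum, hg, smul_zero]

/-- If any `dim E` of `dim E + 1` convex sets are independent, then `0` is in the convex hull of
all choices of one point from each of them, or of none. -/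
theorem zero_mem_convexHull_of_transversal [DecidableEq ι] [FiniteDimensional ℝ E] {S : Finset ι}
    (hS : S.card = Module.finrank ℝ E + 1) {K : ι → Set E} (hK : ∀ c ∈ S, Convex ℝ (K c))
    (hind : ∀ a ∈ S, ∀ u : ι → E, (∀ c ∈ S, u c ∈ K c) → ∀ g : ι → ℝ,
      ∑ c ∈ S.erase a, g c • u c = 0 → ∀ c ∈ S.erase a, g c = 0)
    {u v : ι → E} (hu : ∀ c ∈ S, u c ∈ K c) (hv : ∀ c ∈ S, v c ∈ K c)
    (h0 : (0 : E) ∈ convexHull ℝ (u '' S)) : (0 : E) ∈ convexHull ℝ (v '' S) := by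
  have key : ∀ D ⊆ S, (0 : E) ∈ convexHull ℝ ((fun c => if c ∈ D then v c else u c) '' S) := by
    intro D
    induction D using Finset.induction_on with
    | empty => simpa using h0
    | insert k D hkD ih =>
      intro hD
      rw [Finset.insert_subset_iff] at hD
      have := zero_mem_convexHull_update hS hK hind (u := fun c => if c ∈ D then v c else u c)
        (fun c hc => by split_ifs; exacts [hv c hc, hu c hc]) (ih hD.2) hD.1 (hv k hD.1)
      convert this using 2
      refine Set.image_congr fun c _ => ?_
      by_cases hc : c = k
      · subst hc; simp
      · simp [hc]
  have := key S subset_rfl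
  rwa [Set.image_congr (g := v)] at this
  intro c hc
  simp [Finset.mem_coe.1 hc]

end Combinations

/-! ### Disjoint subfamilies of given size -/

theorem exists_disjoint_subsets {ι κ : Type*} [Fintype κ] (A : Finset ι) (q : ℕ)
    (h : Fintype.card κ * q ≤ A.card) :
    ∃ Z : κ → Finset ι, (∀ j, Z j ⊆ A) ∧ (∀ j, (Z j).card = q) ∧
      ∀ i j, i ≠ j → Disjoint (Z i) (Z j) := by
  classical
  set e : κ × Fin q ↪ ι := (((Fintype.equivFin κ).prodCongr (Equiv.refl (Fin q))).trans
    finProdFinEquiv).toEmbedding.trans ((Fin.castLEEmb h).trans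
      (A.equivFin.symm.toEmbedding.trans (Function.Embedding.subtype (· ∈ A)))) with he
  refine ⟨fun j => Finset.univ.image fun r => e (j, r), fun j => ?_, fun j => ?_,
    fun i j hij => ?_⟩
  · refine Finset.image_subset_iff.2 fun r _ => ?_
    simp [he]
  · rw [Finset.card_image_of_injective, Finset.card_univ, Fintype.card_fin]
    intro r r' hr
    exact (Prod.mk.inj (e.injective hr)).2
  · rw [Finset.disjoint_left]
    intro a ha ha'
    obtain ⟨r, -, rfl⟩ := Finset.mem_image.1 ha
    obtain ⟨r', -, hr'⟩ := Finset.mem_image.1 ha'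
    exact hij (Prod.mk.inj (e.injective hr')).1.symm

/-! ### Vectors in general position and open center regions -/

section GeneralPosition

open Module (finrank)

variable {E ι κ : Type*} [NormedAddCommGroup E] [InnerProductSpace ℝ E]

theorem convex_inner_nonpos (w : E) : Convex ℝ {v : E | inner ℝ w v ≤ 0} :=
  convex_halfSpace_le (innerₛₗ ℝ w).isLinear 0

theorem convex_inner_pos (w : E) : Convex ℝ {v : E | 0 < inner ℝ w v} :=
  convex_halfSpace_gt (innerₛₗ ℝ w).isLinear 0

theorem isOpen_linearIndependent_restrict (T : Finset ι) :
    IsOpen {x : ι → E | LinearIndependent ℝ fun i : T => x i} := by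
  have hc : Continuous fun (x : ι → E) (i : T) => x i := by fun_prop
  exact isOpen_setOfPred_linearIndependent.preimage hc

/-- The sign `1` on `D` and `-1` off `D`. -/
noncomputable def signOn (D : Finset κ) (i : κ) : ℝ := by classical exact if i ∈ D then 1 else -1

theorem signOn_mul_self (D : Finset κ) (i : κ) : signOn D i * signOn D i = 1 := by
  unfold signOn
  split_ifs <;> norm_num

/-- Any `dim E` of the families are independent: a choice of one point from the convex hull of
each of them is linearly independent. -/
def IndependentHulls (x : ι → E) (Y : κ → Finset ι) : Prop :=
  ∀ T : Finset κ, T.card = finrank ℝ E → ∀ u : κ → E, (∀ i ∈ T, u i ∈ convexHull ℝ (x '' Y i)) →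
    ∀ g : κ → ℝ, ∑ i ∈ T, g i • u i = 0 → ∀ i ∈ T, g i = 0

theorem independentHulls_of_separated {x : ι → E} {Y : κ → Finset ι}
    (h : ∀ T D : Finset κ, T.card = finrank ℝ E →
      ∃ w : E, ∀ i ∈ T, ∀ a ∈ Y i, 0 < signOn D i * inner ℝ w (x a)) : IndependentHulls x Y := by
  classical
  intro T hT u hu g hg i hi
  by_contra hgi
  -- Separate according to the signs of the coefficients.
  set D := T.filter fun i => 0 < g i with hD
  obtain ⟨w, hw⟩ := h T D hT
  have hpos : ∀ j ∈ T, 0 < signOn D j * inner ℝ w (u j) := by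
    intro j hj
    have hsub : convexHull ℝ (x '' Y j) ⊆ {v : E | 0 < inner ℝ (signOn D j • w) v} := by
      refine convexHull_min ?_ (convex_inner_pos _)
      rintro _ ⟨a, ha, rfl⟩
      simpa [real_inner_smul_left] using hw j hj a ha
    simpa [real_inner_smul_left] using hsub (hu j hj)
  have habs : ∀ j ∈ T, g j = |g j| * signOn D j := by
    intro j hj
    by_cases h0 : 0 < g j
    · simp [signOn, hD, hj, h0, abs_of_pos h0]
    · simp [signOn, hD, h0, abs_of_nonpos (not_lt.1 h0)]
  have hsum : ∑ j ∈ T, |g j| * (signOn D j * inner ℝ w (u j)) = 0 := by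
    have := congrArg (inner ℝ w) hg
    rw [inner_sum, inner_zero_right] at this
    rw [← this]
    refine Finset.sum_congr rfl fun j hj => ?_
    rw [real_inner_smul_right, ← mul_assoc, ← habs j hj]
  have := (Finset.sum_eq_zero_iff_of_nonneg fun j hj =>
    mul_nonneg (abs_nonneg (g j)) (hpos j hj).le).1 hsum i hi
  exact (mul_pos (abs_pos.2 hgi) (hpos i hi)).ne' this

variable [FiniteDimensional ℝ E]

/-- Any `dim E` members of the family `x` (with different indices) are linearly independent. -/
def IsGeneric (x : ι → E) : Prop :=
  ∀ T : Finset ι, T.card = finrank ℝ E → LinearIndependent ℝ fun i : T => x i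

theorem dense_linearIndependent (T : Finset ι) (hT : T.card = finrank ℝ E) :
    Dense {x : ι → E | LinearIndependent ℝ fun i : T => x i} := by
  classical
  intro x
  set b : Module.Basis T ℝ E :=
    (Module.finBasis ℝ E).reindex (T.equivFinOfCardEq hT).symm with hb
  set f : E →ₗ[ℝ] E := b.constr ℝ fun i : T => x i with hf
  -- Move `x i` along `t • b i`: the result is independent unless `-t` is an eigenvalue of `f`.
  set y : ℝ → ι → E := fun t i => x i + t • (if h : i ∈ T then b ⟨i, h⟩ else 0) with hy
  have hlim : Filter.Tendsto y (nhdsWithin 0 {0}ᶜ) (nhds x) := by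
    have hc : Continuous y := by fun_prop
    have h0 : y 0 = x := by simp [hy]
    exact h0 ▸ hc.continuousAt.tendsto.mono_left nhdsWithin_le_nhds
  refine mem_closure_of_tendsto hlim ?_
  have hfin : {t : ℝ | Module.End.HasEigenvalue f (-t)}.Finite :=
    (Module.End.finite_hasEigenvalue f).preimage neg_injective.injOn
  have hev : ∀ᶠ t in nhdsWithin (0 : ℝ) {0}ᶜ, ¬ Module.End.HasEigenvalue f (-t) := by
    have hcl : IsOpen ({t : ℝ | Module.End.HasEigenvalue f (-t)} \ {0})ᶜ :=
      (hfin.subset Set.sdiff_subset).isClosed.isOpen_compl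
    have h0 : (0 : ℝ) ∈ ({t : ℝ | Module.End.HasEigenvalue f (-t)} \ {0})ᶜ := by simp
    filter_upwards [nhdsWithin_le_nhds (hcl.mem_nhds h0), self_mem_nhdsWithin] with t ht ht0 hev
    exact ht ⟨hev, ht0⟩
  filter_upwards [hev] with t ht
  have hker : LinearMap.ker (f + t • (LinearMap.id : E →ₗ[ℝ] E)) = ⊥ := by
    rw [Module.End.hasEigenvalue_iff, not_not, Module.End.eigenspace_def] at ht
    rw [neg_smul, sub_neg_eq_add] at ht
    exact ht
  have := b.linearIndependent.map' _ hker
  have heq : ⇑(f + t • (LinearMap.id : E →ₗ[ℝ] E)) ∘ ⇑b = fun i : T => y t i := by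
    funext i
    simp [hy, hf]
  rw [heq] at this
  exact this

theorem dense_isGeneric [Finite ι] : Dense {x : ι → E | IsGeneric x} := by
  have : {x : ι → E | IsGeneric x} = ⋂ T : {T : Finset ι // T.card = finrank ℝ E},
      {x : ι → E | LinearIndependent ℝ fun i : T.1 => x i} := by
    ext x
    simp [IsGeneric]
  rw [this]
  exact dense_iInter_of_isOpen (fun T => isOpen_linearIndependent_restrict T.1)
    fun T => dense_linearIndependent T.1 T.2

theorem interior_convexHull_insert_zero_nonempty {x : ι → E} {T : Finset ι}
    (hT : T.card = finrank ℝ E) (hli : LinearIndependent ℝ fun i : T => x i) :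
    (interior (convexHull ℝ (insert 0 (x '' T)))).Nonempty := by
  rw [interior_convexHull_nonempty_iff_affineSpan_eq_top]
  have hspan := hli.span_eq_top_of_card_eq_finrank' (by rw [Fintype.card_coe, hT])
  have hr : Set.range (fun i : T => x i) = x '' T := by
    ext v; simp
  rw [hr] at hspan
  apply SetLike.coe_injective
  rw [affineSpan_insert_zero, hspan]
  rfl

/-- A version of the **centerpoint theorem** with an open set of centers `z`: every open halfspace
`{v | 0 < ⟪w, v⟫}` that contains `z` contains a fixed fraction of the generic family. By Helly's
theorem the interiors of the hulls of `0` and large subfamilies have a common point. -/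
theorem exists_open_centers {x : ι → E} (hx : IsGeneric x) {Y : Finset ι}
    (hY : finrank ℝ E ≤ Y.card) :
    ∃ O : Set E, IsOpen O ∧ O.Nonempty ∧ ∀ z ∈ O, ∀ w : E, 0 < inner ℝ w z →
      Y.card ≤ (2 * finrank ℝ E + 1) * {i ∈ Y | 0 < inner ℝ w (x i)}.card := by
  classical
  set d := finrank ℝ E with hd
  set k := (Y.card - d) / (d + 1) with hk
  have hmul : (d + 1) * k ≤ Y.card - d := Nat.mul_div_le _ _
  have hlt : Y.card - d < (d + 1) * (k + 1) := Nat.lt_mul_div_succ _ (Nat.succ_pos d)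
  clear_value k
  set 𝒜 := Y.powerset.filter fun A => Y.card ≤ A.card + k with h𝒜
  set F : Finset ι → Set E := fun A => interior (convexHull ℝ (insert 0 (x '' A))) with hF
  refine ⟨⋂ A ∈ 𝒜, F A, isOpen_biInter_finset fun A _ => isOpen_interior, ?_, ?_⟩
  · refine Convex.helly_theorem' (𝕜 := ℝ) (fun A _ => (convex_convexHull ℝ _).interior) ?_
    intro I hI hIc
    set B := Y.filter fun i => ∀ A ∈ I, i ∈ A with hB
    have hBY : (Y \ B).card ≤ (d + 1) * k := by
      have hsub : Y \ B ⊆ I.biUnion fun A => Y \ A := by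
        intro i hi
        simp only [hB, Finset.mem_sdiff, Finset.mem_filter, not_and, not_forall] at hi
        obtain ⟨A, hA, hiA⟩ := hi.2 hi.1
        exact Finset.mem_biUnion.2 ⟨A, hA, Finset.mem_sdiff.2 ⟨hi.1, hiA⟩⟩
      refine (Finset.card_le_card hsub).trans ((Finset.card_biUnion_le_card_mul _ _ k ?_).trans
        (Nat.mul_le_mul_right k hIc))
      intro A hA
      have hA' := Finset.mem_filter.1 (hI hA)
      rw [Finset.card_sdiff_of_subset (Finset.mem_powerset.1 hA'.1)]
      omega
    have hBs : B ⊆ Y := Finset.filter_subset _ _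
    have hBc := Finset.card_le_card hBs
    rw [Finset.card_sdiff_of_subset hBs] at hBY
    have hdB : d ≤ B.card := by omega
    obtain ⟨T, hTB, hT⟩ := Finset.exists_subset_card_eq hdB
    refine (interior_convexHull_insert_zero_nonempty hT (hx T hT)).mono ?_
    refine Set.subset_iInter₂ fun A hA => interior_mono (convexHull_mono ?_)
    refine Set.insert_subset_insert (Set.image_mono fun i hi => ?_)
    exact (Finset.mem_filter.1 (hTB hi)).2 A hA
  · intro z hz w hw
    set B := Y.filter fun i => 0 < inner ℝ w (x i) with hB
    have hkB : k < B.card := by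
      by_contra! hle
      have hmem : Y \ B ∈ 𝒜 := by
        refine Finset.mem_filter.2 ⟨Finset.mem_powerset.2 Finset.sdiff_subset, ?_⟩
        have hBs : B ⊆ Y := Finset.filter_subset _ _
        rw [Finset.card_sdiff_of_subset hBs]
        omega
      have hz' := interior_subset (Set.mem_iInter₂.1 hz _ hmem)
      have hsub : convexHull ℝ (insert 0 (x '' (Y \ B : Finset ι))) ⊆
          {v : E | inner ℝ w v ≤ 0} := by
        refine convexHull_min (Set.insert_subset (by simp) ?_) (convex_inner_nonpos w)
        rintro _ ⟨i, hi, rfl⟩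
        rw [Finset.mem_coe, Finset.mem_sdiff, hB, Finset.mem_filter] at hi
        exact not_lt.1 fun h => hi.2 ⟨hi.1, h⟩
      exact absurd hw (not_lt.2 (hsub hz'))
    have h2 : (d + 1) * (k + 1) ≤ (d + 1) * B.card := Nat.mul_le_mul_left _ hkB
    have h3 : d ≤ d * B.card := Nat.le_mul_of_pos_right d (by omega)
    have h4 : (2 * d + 1) * B.card = d * B.card + (d + 1) * B.card := by ring
    omega

theorem exists_inner_eq {T : Finset κ} (hT : T.card = finrank ℝ E) {z : κ → E}
    (hz : LinearIndependent ℝ fun i : T => z i) (a : κ → ℝ) :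
    ∃ w : E, ∀ i ∈ T, inner ℝ w (z i) = a i := by
  have hspan := hz.span_eq_top_of_card_eq_finrank' (by rw [Fintype.card_coe, hT])
  set b := Module.Basis.mk hz hspan.ge with hb
  refine ⟨(InnerProductSpace.toDual ℝ E).symm
    (LinearMap.toContinuousLinearMap (b.constr ℝ fun i : T => a i)), fun i hi => ?_⟩
  rw [InnerProductSpace.toDual_symm_apply, LinearMap.coe_toContinuousLinearMap']
  have h : z i = b ⟨i, hi⟩ := by rw [hb, Module.Basis.mk_apply]
  rw [h, Module.Basis.constr_basis]

/-- A linear hyperplane through independent centers of `dim E` families separates large subfamilies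
in a prescribed way. -/
theorem exists_separated_subfamilies [Finite κ] {x : ι → E} (hx : IsGeneric x) {T : Finset κ}
    (hT : T.card = finrank ℝ E) (D : Finset κ) {Y : κ → Finset ι}
    (hY : ∀ i, finrank ℝ E ≤ (Y i).card) :
    ∃ Y' : κ → Finset ι, (∀ i, Y' i ⊆ Y i) ∧
      (∀ i, (Y i).card ≤ (2 * finrank ℝ E + 1) * (Y' i).card) ∧
      ∃ w : E, ∀ i ∈ T, ∀ a ∈ Y' i, 0 < signOn D i * inner ℝ w (x a) := by
  classical
  choose O hO hOne hOc using fun i => exists_open_centers hx (hY i)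
  obtain ⟨z, hz, hzT⟩ := (dense_linearIndependent (E := E) T hT).inter_open_nonempty
    (Set.univ.pi O) (isOpen_set_pi Set.finite_univ fun i _ => hO i)
    (Set.univ_pi_nonempty_iff.2 hOne)
  obtain ⟨w, hw⟩ := exists_inner_eq hT hzT (signOn D)
  refine ⟨fun i => (Y i).filter fun a => i ∈ T → 0 < signOn D i * inner ℝ w (x a),
    fun i => Finset.filter_subset _ _, fun i => ?_, w, fun i hi a ha =>
      (Finset.mem_filter.1 ha).2 hi⟩
  by_cases hi : i ∈ T
  · have := hOc i (z i) (hz i (Set.mem_univ i)) (signOn D i • w) (by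
      rw [real_inner_smul_left, hw i hi, signOn_mul_self]
      exact one_pos)
    simpa [hi, real_inner_smul_left] using this
  · simp only [hi, false_imp_iff, Finset.filter_true]
    exact Nat.le_mul_of_pos_left _ (by omega)

/-- Large generic families have subfamilies, larger by a constant factor only, that are
independent. -/
theorem exists_independentHulls [Fintype κ] {x : ι → E} (hx : IsGeneric x) {Y : κ → Finset ι}
    (hY : ∀ i, finrank ℝ E * (2 * finrank ℝ E + 1) ^ 4 ^ Fintype.card κ ≤ (Y i).card) :
    ∃ Y' : κ → Finset ι, (∀ i, Y' i ⊆ Y i) ∧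
      (∀ i, (Y i).card ≤ (2 * finrank ℝ E + 1) ^ 4 ^ Fintype.card κ * (Y' i).card) ∧
      IndependentHulls x Y' := by
  classical
  set d := finrank ℝ E with hd
  have key : ∀ 𝒟 : Finset (Finset κ × Finset κ),
      (∀ i, d * (2 * d + 1) ^ 𝒟.card ≤ (Y i).card) →
      ∃ Y' : κ → Finset ι, (∀ i, Y' i ⊆ Y i) ∧
        (∀ i, (Y i).card ≤ (2 * d + 1) ^ 𝒟.card * (Y' i).card) ∧
        ∀ t ∈ 𝒟, t.1.card = d →
          ∃ w : E, ∀ i ∈ t.1, ∀ a ∈ Y' i, 0 < signOn t.2 i * inner ℝ w (x a) := by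
    intro 𝒟
    induction 𝒟 using Finset.induction_on with
    | empty => exact fun _ => ⟨Y, fun i => subset_rfl, by simp, by simp⟩
    | insert t 𝒟 ht ih =>
      intro hY
      rw [Finset.card_insert_of_notMem ht] at hY ⊢
      obtain ⟨Y₁, hY₁, hc₁, hs₁⟩ := ih fun i => le_trans
        (Nat.mul_le_mul_left d (Nat.pow_le_pow_right (by omega) (Nat.le_succ _))) (hY i)
      by_cases htd : t.1.card = d
      · have hbig : ∀ i, d ≤ (Y₁ i).card := by
          intro i
          have h1 := (hY i).trans (hc₁ i)
          rw [pow_succ, mul_left_comm] at h1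
          have h2 := Nat.le_of_mul_le_mul_left h1 (by positivity)
          exact (Nat.le_mul_of_pos_right d (by omega)).trans h2
        obtain ⟨Y₂, hY₂, hc₂, w, hw⟩ := exists_separated_subfamilies hx htd t.2 hbig
        refine ⟨Y₂, fun i => (hY₂ i).trans (hY₁ i), fun i => ?_, fun s hs hsd => ?_⟩
        · calc (Y i).card ≤ (2 * d + 1) ^ 𝒟.card * (Y₁ i).card := hc₁ i
            _ ≤ (2 * d + 1) ^ 𝒟.card * ((2 * d + 1) * (Y₂ i).card) :=
              Nat.mul_le_mul_left _ (hc₂ i)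
            _ = _ := by rw [pow_succ, mul_assoc]
        · rcases Finset.mem_insert.1 hs with rfl | hs
          · exact ⟨w, hw⟩
          · obtain ⟨w', hw'⟩ := hs₁ s hs hsd
            exact ⟨w', fun i hi a ha => hw' i hi a (hY₂ i ha)⟩
      · refine ⟨Y₁, hY₁, fun i => (hc₁ i).trans ?_, fun s hs hsd => ?_⟩
        · exact Nat.mul_le_mul_right _ (Nat.pow_le_pow_right (by omega) (Nat.le_succ _))
        · rcases Finset.mem_insert.1 hs with rfl | hs
          · exact absurd hsd htd
          · exact hs₁ s hs hsd
  have hcard : (Finset.univ : Finset (Finset κ × Finset κ)).card = 4 ^ Fintype.card κ := by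
    rw [Finset.card_univ, Fintype.card_prod, Fintype.card_finset, ← mul_pow]
    norm_num
  have := key Finset.univ (by rwa [hcard])
  rw [hcard] at this
  obtain ⟨Y', h1, h2, h3⟩ := this
  exact ⟨Y', h1, h2, independentHulls_of_separated fun T D hT => h3 (T, D) (Finset.mem_univ _) hT⟩

end GeneralPosition

/-! ### Partitions that are rarely crossed by hyperplanes -/

section Crossing

open Module (finrank)

variable {E ι κ : Type*} [NormedAddCommGroup E] [InnerProductSpace ℝ E]

/-- The hyperplane orthogonal to `w` splits the subfamily `Y` (points on the hyperplane count for
the nonnegative side). -/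
def Crosses (x : ι → E) (w : E) (Y : Finset ι) : Prop :=
  (∃ i ∈ Y, inner ℝ w (x i) < 0) ∧ ∃ i ∈ Y, 0 ≤ inner ℝ w (x i)

theorem Crosses.mono {x : ι → E} {w : E} {Y Z : Finset ι} (h : Crosses x w Y) (hYZ : Y ⊆ Z) :
    Crosses x w Z := by
  obtain ⟨⟨i, hi, hi'⟩, j, hj, hj'⟩ := h
  exact ⟨⟨i, hYZ hi, hi'⟩, j, hYZ hj, hj'⟩

theorem Crosses.exists_inner_eq_zero {x : ι → E} {w : E} {Y : Finset ι} (h : Crosses x w Y) :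
    ∃ u ∈ convexHull ℝ (x '' Y), inner ℝ w u = 0 := by
  obtain ⟨⟨i, hi, hi'⟩, j, hj, hj'⟩ := h
  set α := inner ℝ w (x i)
  set β := inner ℝ w (x j) with hβ
  have hpos : 0 < β - α := by linarith
  refine ⟨(β / (β - α)) • x i + (-α / (β - α)) • x j, ?_, ?_⟩
  · refine convex_convexHull ℝ (x '' Y) (subset_convexHull ℝ _ (Set.mem_image_of_mem x hi))
      (subset_convexHull ℝ _ (Set.mem_image_of_mem x hj)) (by positivity) (div_nonneg (by linarith) hpos.le) ?_
    field_simp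
    ring
  · rw [inner_add_right, real_inner_smul_right, real_inner_smul_right]
    change β / (β - α) * α + -α / (β - α) * β = 0
    ring

theorem IndependentHulls.exists_not_crosses [FiniteDimensional ℝ E] {x : ι → E}
    {Y : κ → Finset ι} (hY : IndependentHulls x Y) {T : Finset κ} (hT : T.card = finrank ℝ E)
    {w : E} (hw : w ≠ 0) : ∃ i ∈ T, ¬ Crosses x w (Y i) := by
  by_contra! hcon
  have : ∀ i, ∃ u, i ∈ T → u ∈ convexHull ℝ (x '' Y i) ∧ inner ℝ w u = 0 := by
    intro i
    by_cases hi : i ∈ T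
    · obtain ⟨u, hu⟩ := (hcon i hi).exists_inner_eq_zero
      exact ⟨u, fun _ => hu⟩
    · exact ⟨0, fun h => absurd h hi⟩
  choose u hu using this
  have hli : LinearIndependent ℝ fun i : T => u i := by
    classical
    rw [Fintype.linearIndependent_iff]
    intro g hg i
    have := hY T hT u (fun i hi => (hu i hi).1) (fun i => if h : i ∈ T then g ⟨i, h⟩ else 0) (by
      rw [← Finset.sum_coe_sort, ← hg]
      exact Finset.sum_congr rfl fun c _ => by simp) i i.2
    simpa using this
  have hspan := hli.span_eq_top_of_card_eq_finrank' (by rw [Fintype.card_coe, hT])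
  have hle : Submodule.span ℝ (Set.range fun i : T => u i) ≤ LinearMap.ker (innerₛₗ ℝ w) := by
    rw [Submodule.span_le]
    rintro _ ⟨i, rfl⟩
    exact (hu i i.2).2
  rw [hspan] at hle
  exact hw (inner_self_eq_zero.1 (hle (Submodule.mem_top : w ∈ ⊤)))

open Classical in
/-- The members of `A` with a given colour. -/
noncomputable def colorClass (A : Finset ι) (g : ι → κ) (c : κ) : Finset ι := {i ∈ A | g i = c}

theorem mem_colorClass {A : Finset ι} {g : ι → κ} {c : κ} {i : ι} :
    i ∈ colorClass A g c ↔ i ∈ A ∧ g i = c := by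
  simp [colorClass]

theorem sum_card_colorClass [Fintype κ] (A : Finset ι) (g : ι → κ) :
    ∑ c, (colorClass A g c).card = A.card := by
  classical
  rw [Finset.card_eq_sum_card_fiberwise (f := g) (t := Finset.univ) fun i _ => by simp]
  rfl

open Classical in
/-- The number of members of `A` whose colour class is split by the hyperplane orthogonal to
`w`. -/
noncomputable def crossMass [Fintype κ] (x : ι → E) (w : E) (A : Finset ι) (g : ι → κ) : ℝ :=
  ∑ c, if Crosses x w (colorClass A g c) then ((colorClass A g c).card : ℝ) else 0

/-- The factor by which families shrink when `m` of them are made independent in dimension `d`. -/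
def shrinkFactor (d m : ℕ) : ℕ := (2 * d + 1) ^ 4 ^ m

theorem shrinkFactor_pos (d m : ℕ) : 0 < shrinkFactor d m := by
  unfold shrinkFactor
  positivity

/-- The number of colours in one refinement step. -/
def splitColors (d : ℕ) : ℕ := d * (d * shrinkFactor d d) + 1

/-- In one refinement step, every hyperplane misses a part of each class that makes up at least
this fraction of it. -/
noncomputable def splitRate (d : ℕ) : ℝ := 1 / (2 * d * shrinkFactor d d)

theorem splitRate_pos {d : ℕ} (hd : 0 < d) : 0 < splitRate d := by
  have := shrinkFactor_pos d d
  unfold splitRate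
  positivity

theorem splitRate_le_one {d : ℕ} (hd : 0 < d) : splitRate d ≤ 1 := by
  have h := shrinkFactor_pos d d
  have h1 : (1 : ℝ) ≤ d := by exact_mod_cast hd
  have h2 : (1 : ℝ) ≤ shrinkFactor d d := by exact_mod_cast h
  unfold splitRate
  rw [div_le_one (by positivity)]
  nlinarith

variable [FiniteDimensional ℝ E]

/-- A generic family has a colouring such that every hyperplane misses a class with a fixed
fraction of the points. -/
theorem exists_coloring_crossMass_le {x : ι → E} (hx : IsGeneric x) (hd : 0 < finrank ℝ E)
    (A : Finset ι) :
    ∃ g : ι → Fin (splitColors (finrank ℝ E)), ∀ w : E, w ≠ 0 →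
      crossMass x w A g ≤ (1 - splitRate (finrank ℝ E)) * A.card := by
  classical
  set d := finrank ℝ E with hd_def
  have hC := shrinkFactor_pos d d
  have hrate := splitRate_le_one hd
  rcases lt_or_ge A.card (d * (d * shrinkFactor d d)) with hsmall | hbig
  · -- A small family is split into single points.
    have hlt : A.card ≤ splitColors d := by unfold splitColors; omega
    set g : ι → Fin (splitColors d) := fun i =>
      if h : i ∈ A then Fin.castLE hlt (A.equivFin ⟨i, h⟩) else ⟨0, Nat.succ_pos _⟩ with hg
    refine ⟨g, fun w _ => ?_⟩
    have h0 : crossMass x w A g = 0 := by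
      refine Finset.sum_eq_zero fun c _ => if_neg ?_
      rintro ⟨⟨i, hi, hi'⟩, j, hj, hj'⟩
      rw [mem_colorClass] at hi hj
      have hij := hi.2.trans hj.2.symm
      simp only [hg, hi.1, hj.1, dif_pos, Fin.castLE_inj, EmbeddingLike.apply_eq_iff_eq,
        Subtype.mk.injEq] at hij
      rw [hij] at hi'
      exact hi'.not_ge hj'
    rw [h0]
    exact mul_nonneg (by linarith) (Nat.cast_nonneg _)
  set q := A.card / d with hq
  have hqd : Fintype.card (Fin d) * q ≤ A.card := by
    rw [Fintype.card_fin]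
    exact Nat.mul_div_le _ _
  have hqC : d * shrinkFactor d d ≤ q := by
    rw [hq, Nat.le_div_iff_mul_le hd, mul_comm]
    exact hbig
  have hqpos : 1 ≤ q := (Nat.mul_pos hd hC).trans_le hqC
  obtain ⟨Z, hZA, hZc, hZd⟩ := exists_disjoint_subsets (κ := Fin d) A q hqd
  obtain ⟨Y, hYZ, hYc, hY⟩ := exists_independentHulls hx (Y := Z) (by
    intro i
    rw [hZc, Fintype.card_fin]
    exact hqC)
  have hlt : d ≤ splitColors d := by
    unfold splitColors
    nlinarith [Nat.mul_pos hd hC]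
  have hlast : d < splitColors d := by
    unfold splitColors
    nlinarith [Nat.mul_pos hd hC]
  set g : ι → Fin (splitColors d) := fun i =>
    if h : ∃ j, i ∈ Y j then Fin.castLE hlt h.choose else ⟨d, hlast⟩ with hg
  have hclass : ∀ j, colorClass A g (Fin.castLE hlt j) = Y j := by
    intro j
    ext i
    rw [mem_colorClass]
    constructor
    · rintro ⟨-, hi⟩
      by_cases h : ∃ j, i ∈ Y j
      · simp only [hg, h, dif_pos, Fin.castLE_inj] at hi
        exact hi ▸ h.choose_spec
      · simp only [hg, h, dif_neg, not_false_eq_true] at hi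
        have := congrArg Fin.val hi
        simp only [Fin.val_castLE] at this
        omega
    · intro hi
      refine ⟨hZA j (hYZ j hi), ?_⟩
      have h : ∃ j, i ∈ Y j := ⟨j, hi⟩
      have hj : h.choose = j := by
        by_contra hne
        exact Finset.disjoint_left.1 (hZd _ _ hne) (hYZ _ h.choose_spec) (hYZ j hi)
      simp only [hg, h, dif_pos, hj]
  refine ⟨g, fun w hw => ?_⟩
  obtain ⟨j, -, hj⟩ := hY.exists_not_crosses (T := Finset.univ) (by simp [hd_def]) hw
  have hle : crossMass x w A g + (Y j).card ≤ A.card := by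
    rw [← sum_card_colorClass A g, Nat.cast_sum, crossMass, ← hclass j,
      ← Finset.add_sum_erase _ _ (Finset.mem_univ (Fin.castLE hlt j)),
      ← Finset.add_sum_erase _ (fun c => ((colorClass A g c).card : ℝ))
        (Finset.mem_univ (Fin.castLE hlt j)), if_neg (by rwa [hclass]), zero_add, add_comm]
    refine add_le_add_right (Finset.sum_le_sum fun c _ => ?_) _
    split_ifs <;> simp
  have hsize : splitRate d * A.card ≤ (Y j).card := by
    have h1 : A.card < d * (q + 1) := Nat.lt_mul_div_succ _ hd
    have h2 : q ≤ shrinkFactor d d * (Y j).card := by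
      have := hYc j
      rwa [hZc, Fintype.card_fin] at this
    have h3 : (A.card : ℝ) ≤ 2 * d * shrinkFactor d d * (Y j).card := by
      have : A.card ≤ 2 * d * shrinkFactor d d * (Y j).card := by
        calc A.card ≤ d * (q + 1) := h1.le
          _ ≤ d * (2 * q) := Nat.mul_le_mul_left _ (by omega)
          _ ≤ d * (2 * (shrinkFactor d d * (Y j).card)) := by gcongr
          _ = _ := by ring
      exact_mod_cast this
    have hpos : (0 : ℝ) < 2 * d * shrinkFactor d d := by positivity
    rw [splitRate, one_div_mul_eq_div, div_le_iff₀ hpos]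
    linarith
  linarith

/-- A weak form of the simplicial partition theorem, by repeated refinement: a generic family has a
colouring, with a number of colours that only depends on `r` and the dimension, such that every
hyperplane splits only classes of total size a small fraction of the family. -/
theorem exists_coloring_crossMass_le_pow {x : ι → E} (hx : IsGeneric x) (hd : 0 < finrank ℝ E)
    (A : Finset ι) (r : ℕ) :
    ∃ (κ : Type) (_ : Fintype κ) (g : ι → κ), Fintype.card κ = splitColors (finrank ℝ E) ^ r ∧
      ∀ w : E, w ≠ 0 → crossMass x w A g ≤ (1 - splitRate (finrank ℝ E)) ^ r * A.card := by
  classical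
  have hrate := splitRate_le_one hd
  induction r with
  | zero =>
    refine ⟨Unit, inferInstance, fun _ => (), by simp, fun w _ => ?_⟩
    rw [pow_zero, one_mul, ← sum_card_colorClass A fun _ => (), Nat.cast_sum, crossMass]
    refine Finset.sum_le_sum fun c _ => ?_
    split_ifs <;> simp
  | succ r ih =>
    obtain ⟨κ, _, g, hκ, hg⟩ := ih
    choose h hh using fun c => exists_coloring_crossMass_le hx hd (colorClass A g c)
    refine ⟨κ × Fin (splitColors (finrank ℝ E)), inferInstance, fun i => (g i, h (g i) i), ?_,
      fun w hw => ?_⟩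
    · rw [Fintype.card_prod, hκ, Fintype.card_fin, pow_succ]
    have hclass : ∀ c k, colorClass A (fun i => (g i, h (g i) i)) (c, k) =
        colorClass (colorClass A g c) (h c) k := by
      intro c k
      ext i
      simp only [mem_colorClass, Prod.mk.injEq]
      constructor
      · rintro ⟨hi, rfl, hk⟩
        exact ⟨⟨hi, rfl⟩, hk⟩
      · rintro ⟨⟨hi, rfl⟩, hk⟩
        exact ⟨hi, rfl, hk⟩
    calc crossMass x w A (fun i => (g i, h (g i) i))
        = ∑ c, crossMass x w (colorClass A g c) (h c) := by
          rw [crossMass, Fintype.sum_prod_type]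
          refine Finset.sum_congr rfl fun c _ => Finset.sum_congr rfl fun k _ => ?_
          rw [hclass]
      _ ≤ ∑ c, (1 - splitRate (finrank ℝ E)) *
            if Crosses x w (colorClass A g c) then ((colorClass A g c).card : ℝ) else 0 := by
          refine Finset.sum_le_sum fun c _ => ?_
          by_cases hc : Crosses x w (colorClass A g c)
          · rw [if_pos hc]
            exact hh c w hw
          · rw [if_neg hc, mul_zero]
            refine (Finset.sum_eq_zero fun k _ => if_neg fun hk => hc (hk.mono ?_)).le
            exact fun i hi => (mem_colorClass.1 hi).1
      _ ≤ _ := by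
          rw [← Finset.mul_sum, pow_succ', mul_assoc]
          exact mul_le_mul_of_nonneg_left (hg w hw) (by linarith)

/-! ### The generic case -/

theorem exists_ne_zero_inner_eq_zero [Fintype κ] (hκ : Fintype.card κ < finrank ℝ E) (u : κ → E) :
    ∃ w : E, w ≠ 0 ∧ ∀ c, inner ℝ w (u c) = 0 := by
  have hlt : Submodule.span ℝ (Set.range u) ≠ ⊤ := by
    intro h
    have := finrank_range_le_card (R := ℝ) u
    rw [Set.finrank, h, finrank_top] at this
    omega
  have hne : (Submodule.span ℝ (Set.range u))ᗮ ≠ ⊥ := by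
    rwa [Ne, Submodule.orthogonal_eq_bot_iff]
  obtain ⟨w, hw, hw0⟩ := Submodule.exists_mem_ne_zero_of_ne_bot hne
  refine ⟨w, hw0, fun c => ?_⟩
  rw [real_inner_comm]
  exact hw _ (Submodule.subset_span ⟨c, rfl⟩)

theorem zero_mem_convexHull_of_forall {u : ι → E} {S : Finset ι}
    (h : ∀ w : E, ∃ i ∈ S, inner ℝ w (u i) ≤ 0) : (0 : E) ∈ convexHull ℝ (u '' S) := by
  by_contra h0
  have hcl : IsClosed (convexHull ℝ (u '' S)) :=
    (S.finite_toSet.image u).isClosed_convexHull ℝ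
  obtain ⟨f, a, hfa, hf⟩ := geometric_hahn_banach_point_closed (convex_convexHull ℝ _) hcl h0
  obtain ⟨i, hi, hle⟩ := h ((InnerProductSpace.toDual ℝ E).symm f)
  rw [InnerProductSpace.toDual_symm_apply] at hle
  have := hf _ (subset_convexHull ℝ _ ⟨i, hi, rfl⟩)
  rw [map_zero] at hfa
  linarith

end Crossing

section Depth

open Module (finrank)

variable {E ι : Type*} [NormedAddCommGroup E] [InnerProductSpace ℝ E] [FiniteDimensional ℝ E]

/-- There are at most `dim E + 1` disjoint subfamilies of `A`, each with at least `c` members, such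
that every choice of one point from each of them has `0` in its convex hull. -/
def HasDeepTransversals (x : ι → E) (A : Finset ι) (c : ℝ) : Prop :=
  ∃ m ≤ finrank ℝ E + 1, ∃ Y : Fin m → Finset ι, (∀ j, Y j ⊆ A) ∧
    (∀ i j, i ≠ j → Disjoint (Y i) (Y j)) ∧ (∀ j, c ≤ (Y j).card) ∧
    ∀ y : Fin m → ι, (∀ j, y j ∈ Y j) → (0 : E) ∈ convexHull ℝ (Set.range fun j => x (y j))

/-- If every open halfspace with `0` on its boundary contains a whole class from an independent
collection of classes, then a fixed choice of `dim E + 1` classes works for all choices of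
points. -/
theorem IndependentHulls.exists_transversals {κ : Type*} [Fintype κ] (hd : 0 < finrank ℝ E)
    {x : ι → E} {Y : κ → Finset ι} (hY : IndependentHulls x Y) (hne : ∀ c, (Y c).Nonempty)
    (hdeep : ∀ w : E, w ≠ 0 → ∃ c, ∀ i ∈ Y c, inner ℝ w (x i) < 0) :
    ∃ S : Finset κ, S.card = finrank ℝ E + 1 ∧ ∀ y : κ → ι, (∀ c ∈ S, y c ∈ Y c) →
      (0 : E) ∈ convexHull ℝ ((fun c => x (y c)) '' S) := by
  classical
  choose y₀ hy₀ using hne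
  have : Nontrivial E := Module.finrank_pos_iff.1 hd
  obtain ⟨w₀, hw₀⟩ := exists_ne (0 : E)
  have h0 : (0 : E) ∈ convexHull ℝ ((fun c => x (y₀ c)) '' (Finset.univ : Finset κ)) := by
    refine zero_mem_convexHull_of_forall fun w => ?_
    by_cases hw : w = 0
    · obtain ⟨c, -⟩ := hdeep w₀ hw₀
      exact ⟨c, Finset.mem_univ c, by simp [hw]⟩
    · obtain ⟨c, hc⟩ := hdeep w hw
      exact ⟨c, Finset.mem_univ c, (hc _ (hy₀ c)).le⟩
  obtain ⟨S, -, hSc, hS⟩ := exists_subset_card_le_mem_convexHull h0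
  have hκ : finrank ℝ E ≤ Fintype.card κ := by
    by_contra! hlt
    obtain ⟨w, hw, hw0⟩ := exists_ne_zero_inner_eq_zero hlt fun c => x (y₀ c)
    obtain ⟨c, hc⟩ := hdeep w hw
    exact (hc _ (hy₀ c)).ne (hw0 c)
  have hmem : ∀ y : κ → ι, ∀ c, y c ∈ Y c → x (y c) ∈ convexHull ℝ (x '' Y c) := fun y c hc =>
    subset_convexHull ℝ _ ⟨y c, hc, rfl⟩
  have hScard : S.card = finrank ℝ E + 1 := by
    by_contra hne
    obtain ⟨T, hST, -, hT⟩ := Finset.exists_subsuperset_card_eq (Finset.subset_univ S)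
      (show S.card ≤ finrank ℝ E by omega) (by rwa [Finset.card_univ])
    obtain ⟨g, -, hg1, hg0⟩ := mem_convexHull_image_iff.1 (convexHull_mono (Set.image_mono
      (Finset.coe_subset.2 hST)) hS)
    have := hY T hT (fun c => x (y₀ c)) (fun c _ => hmem y₀ c (hy₀ c)) g hg0
    rw [Finset.sum_eq_zero this] at hg1
    exact zero_ne_one hg1
  refine ⟨S, hScard, fun y hy => ?_⟩
  refine zero_mem_convexHull_of_transversal hScard (K := fun c => convexHull ℝ (x '' Y c))
    (fun c _ => convex_convexHull ℝ _) ?_ (fun c _ => hmem y₀ c (hy₀ c))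
    (fun c hc => hmem y c (hy c hc)) hS
  intro a ha u hu g hg
  refine hY (S.erase a) ?_ u (fun c hc => hu c (Finset.mem_of_mem_erase hc)) g hg
  rw [Finset.card_erase_of_mem ha, hScard, Nat.add_sub_cancel]

/-- The case of a large generic family and of open halfspaces. -/
theorem exists_transversals_of_isGeneric (d : ℕ) (hd : 0 < d) (τ : ℝ) (hτ : 0 < τ) :
    ∃ c > (0 : ℝ), ∃ N₀ : ℕ, ∀ (E : Type) [NormedAddCommGroup E] [InnerProductSpace ℝ E]
      [FiniteDimensional ℝ E], finrank ℝ E = d → ∀ (ι : Type) (x : ι → E), IsGeneric x →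
      ∀ (A : Finset ι) (N : ℕ), N₀ ≤ N → A.card ≤ N →
      (∀ w : E, w ≠ 0 → τ * N ≤ {i ∈ A | inner ℝ w (x i) < 0}.card) →
      HasDeepTransversals x A (c * N) := by
  have hrate0 := splitRate_pos hd
  have hrate1 := splitRate_le_one hd
  obtain ⟨r, hr⟩ := exists_pow_lt_of_lt_one (show 0 < τ / 4 by positivity)
    (show 1 - splitRate d < 1 by linarith)
  set M := splitColors d ^ r with hM
  have hMpos : 0 < M := pow_pos (Nat.succ_pos _) _
  set θ := τ / (4 * M) with hθ
  have hθ0 : 0 < θ := by positivity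
  set C := shrinkFactor d M with hC
  have hCpos : 0 < C := shrinkFactor_pos d M
  refine ⟨θ / C, by positivity, ⌈d * C / θ⌉₊ + 1, ?_⟩
  intro E _ _ _ hE ι x hx A N hN hAN hdepth
  classical
  have hNpos : 0 < N := by omega
  have hNreal : (0 : ℝ) < N := by exact_mod_cast hNpos
  obtain ⟨κ, _, g, hκ, hg⟩ := exists_coloring_crossMass_le_pow hx (hE ▸ hd) A r
  rw [hE] at hκ hg
  -- Only the large classes are kept.
  set P := colorClass A g with hP
  set κ' := {c : κ // θ * N ≤ (P c).card} with hκ'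
  have hκ'M : Fintype.card κ' ≤ M := (Fintype.card_subtype_le _).trans hκ.le
  have hbig : ∀ c : κ', d * C ≤ (P c).card := by
    intro c
    have h1 : (d : ℝ) * C / θ ≤ N :=
      (Nat.le_ceil _).trans (Nat.cast_le.2 (by omega))
    rw [div_le_iff₀ hθ0] at h1
    have h2 := h1.trans ((mul_comm _ _).le.trans c.2)
    exact_mod_cast h2
  have hshrink : shrinkFactor d (Fintype.card κ') ≤ C :=
    Nat.pow_le_pow_right (by omega) (Nat.pow_le_pow_right (by omega) hκ'M)
  have hdeep : ∀ w : E, w ≠ 0 → ∃ c : κ', ∀ i ∈ P c, inner ℝ w (x i) < 0 := by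
    intro w hw
    by_contra! hcon
    have hterm : ∀ c, (({i ∈ P c | inner ℝ w (x i) < 0}.card : ℕ) : ℝ) ≤
        (if Crosses x w (P c) then ((P c).card : ℝ) else 0) + θ * N := by
      intro c
      have hle : (({i ∈ P c | inner ℝ w (x i) < 0}.card : ℕ) : ℝ) ≤ (P c).card := by
        exact_mod_cast Finset.card_filter_le _ _
      have hnn : 0 ≤ θ * N := by positivity
      split_ifs with hc
      · linarith
      by_cases hbc : θ * N ≤ (P c).card
      · obtain ⟨j, hj, hj0⟩ := hcon ⟨c, hbc⟩
        have : {i ∈ P c | inner ℝ w (x i) < 0} = ∅ := by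
          refine Finset.filter_eq_empty_iff.2 fun i hi hi0 => hc ⟨⟨i, hi, hi0⟩, j, hj, hj0⟩
        rw [this]
        simpa using hnn
      · linarith
    have hsum : (({i ∈ A | inner ℝ w (x i) < 0}.card : ℕ) : ℝ) =
        ∑ c, (({i ∈ P c | inner ℝ w (x i) < 0}.card : ℕ) : ℝ) := by
      rw [← sum_card_colorClass _ g, Nat.cast_sum]
      refine Finset.sum_congr rfl fun c _ => ?_
      congr 2
      ext i
      simp only [mem_colorClass, hP, Finset.mem_filter]
      tauto
    have h1 := hdepth w hw
    rw [hsum] at h1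
    have h2 := h1.trans (Finset.sum_le_sum fun c _ => hterm c)
    rw [Finset.sum_add_distrib, Finset.sum_const, Finset.card_univ, hκ, nsmul_eq_mul] at h2
    have h3 : crossMass x w A g ≤ τ / 4 * N := by
      refine (hg w hw).trans (mul_le_mul hr.le ?_ (Nat.cast_nonneg _) (by positivity))
      exact_mod_cast hAN
    have h4 : (M : ℝ) * (θ * N) = τ / 4 * N := by
      rw [hθ]
      field_simp
    have h5 : 0 < τ * N := by positivity
    unfold crossMass at h3
    rw [← hM, h4] at h2
    linarith
  obtain ⟨Y, hYP, hYc, hY⟩ := exists_independentHulls hx (Y := fun c : κ' => P c) (by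
    intro c
    rw [hE]
    exact (Nat.mul_le_mul_left d hshrink).trans (hbig c))
  have hYsize : ∀ c, θ / C * N ≤ (Y c).card := by
    intro c
    have h1 : (P c).card ≤ C * (Y c).card := by
      refine (hYc c).trans (Nat.mul_le_mul_right _ ?_)
      rw [hE]
      exact hshrink
    have h2 : ((P c).card : ℝ) ≤ C * (Y c).card := by exact_mod_cast h1
    have h3 := c.2.trans h2
    have hC0 : (0 : ℝ) < C := by exact_mod_cast hCpos
    rw [div_mul_eq_mul_div, div_le_iff₀ hC0]
    linarith
  have hYne : ∀ c, (Y c).Nonempty := by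
    intro c
    have h1 := hYsize c
    have h2 : 0 < θ / C * N := by positivity
    exact Finset.card_pos.1 (by exact_mod_cast h2.trans_le h1)
  obtain ⟨S, hSc, hS⟩ := hY.exists_transversals (hE ▸ hd) hYne fun w hw => by
    obtain ⟨c, hc⟩ := hdeep w hw
    exact ⟨c, fun i hi => hc i (hYP c hi)⟩
  set e := S.equivFinOfCardEq hSc with he
  refine ⟨finrank ℝ E + 1, le_rfl, fun j => Y (e.symm j), fun j => ?_, fun i j hij => ?_,
    fun j => hYsize _, fun y hy => ?_⟩
  · exact (hYP _).trans fun i hi => (mem_colorClass.1 hi).1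
  · refine Finset.disjoint_left.2 fun a ha ha' => hij ?_
    have h1 := (mem_colorClass.1 (hYP _ ha)).2
    have h2 := (mem_colorClass.1 (hYP _ ha')).2
    exact e.symm.injective (Subtype.ext (Subtype.ext (h1.symm.trans h2)))
  · have hι : Nonempty ι := ⟨y 0⟩
    have := hS (fun c => if h : c ∈ S then y (e ⟨c, h⟩) else hι.some) (by
      intro c hc
      simpa [hc] using hy (e ⟨c, hc⟩))
    refine convexHull_mono ?_ this
    rintro _ ⟨c, hc, rfl⟩
    exact ⟨e ⟨c, hc⟩, by simp [Finset.mem_coe.1 hc]⟩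

end Depth

/-! ### Reduction to the generic case -/

section Reduction

open Module (finrank)

variable {E ι : Type*} [NormedAddCommGroup E] [InnerProductSpace ℝ E]

theorem HasDeepTransversals.mono {x : ι → E} {A : Finset ι} {c c' : ℝ}
    (h : HasDeepTransversals x A c) (hc : c' ≤ c) : HasDeepTransversals x A c' := by
  obtain ⟨m, hm, Y, h1, h2, h3, h4⟩ := h
  exact ⟨m, hm, Y, h1, h2, fun j => hc.trans (h3 j), h4⟩

/-- If at most `b` points on the hyperplane orthogonal to `w` lie in its closed halfspace given by
`v`, then tilting `w` towards `v` bounds the number of points in the open halfspace of `w`. -/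
theorem le_card_inner_neg {x : ι → E} {A : Finset ι} {a b : ℝ} {w v : E}
    (hdepth : ∀ w : E, a ≤ {i ∈ A | inner ℝ w (x i) ≤ 0}.card)
    (hv : ({i ∈ A | inner ℝ w (x i) = 0 ∧ inner ℝ v (x i) ≤ 0}.card : ℝ) ≤ b) :
    a - b ≤ {i ∈ A | inner ℝ w (x i) < 0}.card := by
  classical
  have hev : ∀ᶠ η : ℝ in nhds 0, ∀ i ∈ {i ∈ A | 0 < inner ℝ w (x i)},
      0 < inner ℝ w (x i) + η * inner ℝ v (x i) := by
    refine (Filter.eventually_all_finset _).2 fun i hi => ?_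
    have hc : Continuous fun η : ℝ => (inner ℝ w (x i) + η * inner ℝ v (x i) : ℝ) := by fun_prop
    refine continuousAt_const.eventually_lt hc.continuousAt ?_
    simpa using (Finset.mem_filter.1 hi).2
  obtain ⟨η, hη, hη0 : 0 < η⟩ := ((hev.filter_mono nhdsWithin_le_nhds).and
    (self_mem_nhdsWithin : Set.Ioi (0 : ℝ) ∈ nhdsWithin 0 (Set.Ioi 0))).exists
  have hsub : {i ∈ A | inner ℝ (w + η • v) (x i) ≤ 0} ⊆ {i ∈ A | inner ℝ w (x i) < 0} ∪
      {i ∈ A | inner ℝ w (x i) = 0 ∧ inner ℝ v (x i) ≤ 0} := by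
    intro i hi
    rw [Finset.mem_filter, inner_add_left, real_inner_smul_left] at hi
    rw [Finset.mem_union, Finset.mem_filter, Finset.mem_filter]
    rcases lt_trichotomy (inner ℝ w (x i)) 0 with h | h | h
    · exact Or.inl ⟨hi.1, h⟩
    · refine Or.inr ⟨hi.1, h, ?_⟩
      have := hi.2
      rw [h, zero_add] at this
      by_contra! hpos
      exact (mul_pos hη0 hpos).not_ge this
    · exact absurd hi.2 (hη i (Finset.mem_filter.2 ⟨hi.1, h⟩)).not_ge
  have h1 := hdepth (w + η • v)
  have h2 := (Finset.card_le_card hsub).trans (Finset.card_union_le _ _)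
  have h3 : ({i ∈ A | inner ℝ (w + η • v) (x i) ≤ 0}.card : ℝ) ≤
      {i ∈ A | inner ℝ w (x i) < 0}.card +
      {i ∈ A | inner ℝ w (x i) = 0 ∧ inner ℝ v (x i) ≤ 0}.card := by exact_mod_cast h2
  linarith

variable [FiniteDimensional ℝ E]

/-- A lower bound for the numbers of points in the open halfspaces with `0` on the boundary
survives small perturbations: the unit sphere is compact. -/
theorem eventually_forall_le_card_inner_neg {x : ι → E} {A : Finset ι} {k : ℝ}
    (h : ∀ w : E, w ≠ 0 → k ≤ {i ∈ A | inner ℝ w (x i) < 0}.card) :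
    ∀ᶠ x' in nhds x, ∀ w : E, w ≠ 0 → k ≤ {i ∈ A | inner ℝ w (x' i) < 0}.card := by
  have hsphere : ∀ᶠ x' in nhds x, ∀ w ∈ Metric.sphere (0 : E) 1,
      k ≤ {i ∈ A | inner ℝ w (x' i) < 0}.card := by
    refine (isCompact_sphere (0 : E) 1).eventually_forall_of_forall_eventually
      (P := fun (x' : ι → E) w => k ≤ {i ∈ A | inner ℝ w (x' i) < 0}.card) fun w hw => ?_
    have hw0 : w ≠ 0 := by
      rintro rfl
      simp at hw
    have hev : ∀ᶠ z : (ι → E) × E in nhds (x, w), ∀ i ∈ {i ∈ A | inner ℝ w (x i) < 0},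
        inner ℝ z.2 (z.1 i) < 0 := by
      refine (Filter.eventually_all_finset _).2 fun i hi => ?_
      have hc : Continuous fun z : (ι → E) × E => (inner ℝ z.2 (z.1 i) : ℝ) := by fun_prop
      exact hc.continuousAt.eventually_lt continuousAt_const (Finset.mem_filter.1 hi).2
    filter_upwards [hev] with z hz
    refine (h w hw0).trans (Nat.cast_le.2 (Finset.card_le_card fun i hi => ?_))
    exact Finset.mem_filter.2 ⟨(Finset.mem_filter.1 hi).1, hz i hi⟩
  filter_upwards [hsphere] with x' hx' w hw
  have hpos : 0 < ‖w‖⁻¹ := inv_pos.2 (norm_pos_iff.2 hw)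
  have := hx' (‖w‖⁻¹ • w) (by simp [norm_smul, hw])
  simpa [real_inner_smul_left, mul_neg_iff, hpos, hpos.not_gt] using this

theorem eventually_zero_mem_convexHull_imp [Finite ι] (x : ι → E) :
    ∀ᶠ x' in nhds x, ∀ S : Finset ι, (0 : E) ∈ convexHull ℝ (x' '' S) →
      (0 : E) ∈ convexHull ℝ (x '' S) := by
  refine Filter.eventually_all.2 fun S => ?_
  by_cases h0 : (0 : E) ∈ convexHull ℝ (x '' S)
  · exact Filter.Eventually.of_forall fun _ _ => h0
  obtain ⟨w, hw⟩ : ∃ w : E, ∀ i ∈ S, 0 < inner ℝ w (x i) := by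
    by_contra! hcon
    exact h0 (zero_mem_convexHull_of_forall hcon)
  have hev : ∀ᶠ x' in nhds x, ∀ i ∈ S, 0 < inner ℝ w (x' i) := by
    refine (Filter.eventually_all_finset _).2 fun i hi => ?_
    have hc : Continuous fun x' : ι → E => (inner ℝ w (x' i) : ℝ) := by fun_prop
    exact continuousAt_const.eventually_lt hc.continuousAt (hw i hi)
  filter_upwards [hev] with x' hx' hmem
  have hsub : convexHull ℝ (x' '' S) ⊆ {v : E | 0 < inner ℝ w v} := by
    refine convexHull_min ?_ (convex_inner_pos w)
    rintro _ ⟨i, hi, rfl⟩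
    exact hx' i hi
  simpa using hsub hmem

/-- Carathéodory's theorem, as the case of subfamilies with one member. -/
theorem hasDeepTransversals_one {x : ι → E} {A : Finset ι}
    (h0 : (0 : E) ∈ convexHull ℝ (x '' A)) : HasDeepTransversals x A 1 := by
  obtain ⟨S, hSA, hSc, hS⟩ := exists_subset_card_le_mem_convexHull h0
  refine ⟨S.card, hSc, fun j => {(S.equivFin.symm j : ι)}, fun j => ?_, fun i j hij => ?_,
    fun j => by simp, fun y hy => ?_⟩
  · exact Finset.singleton_subset_iff.2 (hSA (S.equivFin.symm j).2)
  · rw [Finset.disjoint_singleton]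
    exact fun h => hij (S.equivFin.symm.injective (Subtype.ext h))
  · refine convexHull_mono ?_ hS
    rintro _ ⟨i, hi, rfl⟩
    refine ⟨S.equivFin ⟨i, hi⟩, ?_⟩
    have := Finset.mem_singleton.1 (hy (S.equivFin ⟨i, hi⟩))
    simp [this]

/-- The case of open halfspaces. -/
theorem exists_transversals_of_open_depth (d : ℕ) (hd : 0 < d) (τ : ℝ) (hτ : 0 < τ) :
    ∃ c > (0 : ℝ), ∀ (E : Type) [NormedAddCommGroup E] [InnerProductSpace ℝ E]
      [FiniteDimensional ℝ E], finrank ℝ E = d → ∀ (ι : Type) [Finite ι] (x : ι → E)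
      (A : Finset ι) (N : ℕ), 0 < N → A.card ≤ N →
      (∀ w : E, w ≠ 0 → τ * N ≤ {i ∈ A | inner ℝ w (x i) < 0}.card) →
      HasDeepTransversals x A (c * N) := by
  obtain ⟨c, hc, N₀, h⟩ := exists_transversals_of_isGeneric d hd τ hτ
  refine ⟨min c (1 / (N₀ + 1)), by positivity, ?_⟩
  intro E _ _ _ hE ι _ x A N hN hAN hdepth
  rcases lt_or_ge N N₀ with hsmall | hbig
  · have hone : min c (1 / ((N₀ : ℝ) + 1)) * N ≤ 1 := by
      have h1 : (N : ℝ) ≤ N₀ + 1 := by exact_mod_cast hsmall.le.trans (Nat.le_succ _)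
      calc min c (1 / ((N₀ : ℝ) + 1)) * N ≤ 1 / ((N₀ : ℝ) + 1) * (N₀ + 1) := by
            gcongr
            exact min_le_right _ _
        _ = 1 := by field_simp
    refine (hasDeepTransversals_one (zero_mem_convexHull_of_forall fun w => ?_)).mono hone
    have hex : ∀ w : E, w ≠ 0 → ∃ i ∈ A, inner ℝ w (x i) < 0 := by
      intro w hw
      have h1 := hdepth w hw
      have h2 : 0 < τ * N := by positivity
      have h3 : 0 < {i ∈ A | inner ℝ w (x i) < 0}.card := by exact_mod_cast h2.trans_le h1
      obtain ⟨i, hi⟩ := Finset.card_pos.1 h3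
      exact ⟨i, Finset.mem_filter.1 hi⟩
    by_cases hw : w = 0
    · have : Nontrivial E := Module.finrank_pos_iff.1 (hE ▸ hd)
      obtain ⟨w₀, hw₀⟩ := exists_ne (0 : E)
      obtain ⟨i, hi, -⟩ := hex w₀ hw₀
      exact ⟨i, hi, by simp [hw]⟩
    · obtain ⟨i, hi, hi'⟩ := hex w hw
      exact ⟨i, hi, hi'.le⟩
  · obtain ⟨x', hgen, hdepth', hhull⟩ := (mem_closure_iff_frequently.1
      (dense_isGeneric (E := E) x)).and_eventually ((eventually_forall_le_card_inner_neg hdepth).and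
        (eventually_zero_mem_convexHull_imp x)) |>.exists
    obtain ⟨m, hm, Y, h1, h2, h3, h4⟩ := h E hE ι x' hgen A N hbig hAN hdepth'
    refine HasDeepTransversals.mono ⟨m, hm, Y, h1, h2, h3, fun y hy => ?_⟩
      (mul_le_mul_of_nonneg_right (min_le_left _ _) (Nat.cast_nonneg N))
    classical
    have himg : ∀ z : ι → E, z '' (Finset.univ.image y : Finset ι) =
        Set.range fun j => z (y j) := by
      intro z
      ext v
      simp
    have := hhull (Finset.univ.image y)
    rw [himg, himg] at this
    exact this (h4 y hy)

/-- The depth version of **Carathéodory's theorem**, at the origin. By induction on the dimension: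
either `0` is deep in the part of the family on some hyperplane, or it is deep with respect to
open halfspaces. -/
theorem exists_transversals_of_depth (d : ℕ) : ∀ τ : ℝ, 0 < τ →
    ∃ c > (0 : ℝ), ∀ (E : Type) [NormedAddCommGroup E] [InnerProductSpace ℝ E]
      [FiniteDimensional ℝ E], finrank ℝ E = d → ∀ (ι : Type) [Finite ι] (x : ι → E)
      (A : Finset ι) (N : ℕ), 0 < N → A.card ≤ N →
      (∀ w : E, τ * N ≤ {i ∈ A | inner ℝ w (x i) ≤ 0}.card) →
      HasDeepTransversals x A (c * N) := by
  induction d with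
  | zero =>
    intro τ hτ
    refine ⟨τ, hτ, fun E _ _ _ hE ι _ x A N hN _ hdepth => ?_⟩
    have hsub : Subsingleton E := Module.finrank_zero_iff.1 hE
    refine ⟨1, by omega, fun _ => A, fun _ => subset_rfl, fun i j hij =>
      absurd (Subsingleton.elim i j) hij, fun _ => by simpa using hdepth 0, fun y _ => ?_⟩
    exact subset_convexHull ℝ _ ⟨0, Subsingleton.elim _ _⟩
  | succ d ih =>
    intro τ hτ
    obtain ⟨c₁, hc₁, h₁⟩ := exists_transversals_of_open_depth (d + 1) d.succ_pos (τ / 2)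
      (by positivity)
    obtain ⟨c₂, hc₂, h₂⟩ := ih (τ / 2) (by positivity)
    refine ⟨min c₁ c₂, lt_min hc₁ hc₂, fun E _ _ _ hE ι _ x A N hN hAN hdepth => ?_⟩
    classical
    by_cases hcase : ∃ w : E, w ≠ 0 ∧ ∀ v : E, inner ℝ w v = 0 →
        τ / 2 * N ≤ {i ∈ A | inner ℝ w (x i) = 0 ∧ inner ℝ v (x i) ≤ 0}.card
    · obtain ⟨w, hw, hwv⟩ := hcase
      set L : Submodule ℝ E := (Submodule.span ℝ {w})ᗮ with hL
      have hmemL : ∀ v, v ∈ L ↔ inner ℝ w v = 0 := fun v =>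
        Submodule.mem_orthogonal_singleton_iff_inner_right
      have : Fact (finrank ℝ E = d + 1) := ⟨hE⟩
      have hLd : finrank ℝ L = d := Submodule.finrank_orthogonal_span_singleton hw
      set x' : ι → L := fun i => if h : x i ∈ L then ⟨x i, h⟩ else 0 with hx'
      set A' := A.filter fun i => inner ℝ w (x i) = 0 with hA'
      have hval : ∀ i ∈ A', (x' i : E) = x i := by
        intro i hi
        have : x i ∈ L := (hmemL _).2 (Finset.mem_filter.1 hi).2
        simp [hx', this]
      obtain ⟨m, hm, Y, hYA, hYd, hYc, hY⟩ := h₂ L hLd ι x' A' N hN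
        ((Finset.card_filter_le _ _).trans hAN) (by
          intro v
          refine (hwv v ((hmemL _).1 v.2)).trans (Nat.cast_le.2 (Finset.card_le_card fun i hi => ?_))
          rw [Finset.mem_filter] at hi
          have hiA' : i ∈ A' := Finset.mem_filter.2 ⟨hi.1, hi.2.1⟩
          refine Finset.mem_filter.2 ⟨hiA', ?_⟩
          rw [Submodule.coe_inner, hval i hiA']
          exact hi.2.2)
      refine HasDeepTransversals.mono (c := c₂ * N) ⟨m, by omega, Y, fun j =>
        (hYA j).trans (Finset.filter_subset _ _), hYd, hYc, fun y hy => ?_⟩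
        (mul_le_mul_of_nonneg_right (min_le_right _ _) (Nat.cast_nonneg N))
      have h0 := Set.mem_image_of_mem L.subtype (hY y hy)
      rw [LinearMap.image_convexHull, map_zero, ← Set.range_comp] at h0
      convert h0 using 2
      refine congrArg Set.range (funext fun j => ?_)
      exact (hval _ (hYA j (hy j))).symm
    · push Not at hcase
      refine (h₁ E hE ι x A N hN hAN fun w hw => ?_).mono
        (mul_le_mul_of_nonneg_right (min_le_left _ _) (Nat.cast_nonneg N))
      obtain ⟨v, -, hv⟩ := hcase w hw
      have := le_card_inner_neg hdepth hv.le
      linarith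

end Reduction

/-! ### The constants and the depth version of Carathéodory's theorem -/

section Constants

open Module (finrank)

/-- A constant for the depth version of Carathéodory's theorem in dimension `d` at depth `τ`, with
at most `d + 1` subfamilies. -/
noncomputable def depthRate (d : ℕ) (τ : ℝ) : ℝ :=
  if h : 0 < τ then (exists_transversals_of_depth d τ h).choose else 0

theorem depthRate_pos (d : ℕ) {τ : ℝ} (hτ : 0 < τ) : 0 < depthRate d τ := by
  rw [depthRate, dif_pos hτ]
  exact (exists_transversals_of_depth d τ hτ).choose_spec.1

theorem hasDeepTransversals_depthRate {E : Type} [NormedAddCommGroup E] [InnerProductSpace ℝ E]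
    [FiniteDimensional ℝ E] {ι : Type} [Finite ι] {x : ι → E} {A : Finset ι} {N : ℕ} {τ : ℝ}
    (hτ : 0 < τ) (hN : 0 < N) (hA : A.card ≤ N)
    (h : ∀ w : E, τ * N ≤ {i ∈ A | inner ℝ w (x i) ≤ 0}.card) :
    HasDeepTransversals x A (depthRate (finrank ℝ E) τ * N) := by
  rw [depthRate, dif_pos hτ]
  exact (exists_transversals_of_depth _ τ hτ).choose_spec.2 E rfl ι x A N hN hA h

/-- The constant `c(d, t)`. The value of `depthRate` at `t / (2 * (d + 1))` and the bound `t / 2`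
serve the Helly type theorem, the bound `1 / (2 * (d + 1))` leaves room for `d + 1` disjoint
subfamilies. -/
noncomputable def depthConstant (d : ℕ) (t : ℝ) : ℝ :=
  if 0 < t then
    min (min (depthRate d t) (depthRate d (t / (2 * (d + 1))))) (min (t / 2) (1 / (2 * (d + 1))))
  else 0

theorem depthConstant_pos (d : ℕ) {t : ℝ} (ht : 0 < t) :
    0 < depthConstant d t := by
  rw [depthConstant, if_pos ht]
  have h1 := depthRate_pos d ht
  have h2 := depthRate_pos d (τ := t / (2 * (d + 1))) (by positivity)
  exact lt_min (lt_min h1 h2) (lt_min (by positivity) (by positivity))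

/-- Further subfamilies can be added to reach `dim E + 1` of them. -/
theorem HasDeepTransversals.exists_fin {E : Type*} [NormedAddCommGroup E] [InnerProductSpace ℝ E]
    {n D : ℕ} (hD : finrank ℝ E + 1 = D) {x : Fin n → E} {c : ℝ}
    (h : HasDeepTransversals x Finset.univ c) (hc : D * ⌈c⌉₊ ≤ n) :
    ∃ X : Fin D → Finset (Fin n), (∀ i j, i ≠ j → Disjoint (X i) (X j)) ∧
      (∀ i, c ≤ (X i).card) ∧ ∀ y : Fin D → Fin n, (∀ i, y i ∈ X i) →
        (0 : E) ∈ convexHull ℝ (Set.range fun i => x (y i)) := by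
  obtain ⟨m, hm, Y, -, hYd, hYc, hY⟩ := h
  rw [hD] at hm
  clear hD
  obtain ⟨r, rfl⟩ := Nat.exists_eq_add_of_le hm
  choose Y' hY'Y hY'c using fun j => Finset.exists_subset_card_eq (Nat.ceil_le.2 (hYc j))
  have hunion : (Finset.univ.biUnion Y').card = m * ⌈c⌉₊ := by
    rw [Finset.card_biUnion fun i _ j _ hij => (hYd i j hij).mono (hY'Y i) (hY'Y j)]
    simp [hY'c]
  obtain ⟨Z, hZ, hZc, hZd⟩ := exists_disjoint_subsets (κ := Fin r)
    (Finset.univ \ Finset.univ.biUnion Y') ⌈c⌉₊ (by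
      rw [Finset.card_sdiff_of_subset (Finset.subset_univ _), hunion, Finset.card_univ,
        Fintype.card_fin, Fintype.card_fin, Nat.le_sub_iff_add_le' (by nlinarith)]
      linarith)
  have hYZ : ∀ i j, Disjoint (Y' i) (Z j) := by
    intro i j
    refine Finset.disjoint_left.2 fun a ha ha' => ?_
    exact (Finset.mem_sdiff.1 (hZ j ha')).2 (Finset.mem_biUnion.2 ⟨i, Finset.mem_univ i, ha⟩)
  refine ⟨Fin.append Y' Z, fun i j => ?_, fun i => ?_, fun y hy => ?_⟩
  · refine Fin.addCases (fun i => ?_) (fun i => ?_) i <;>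
      refine Fin.addCases (fun j => ?_) (fun j => ?_) j <;>
      simp only [Fin.append_left, Fin.append_right] <;> intro hij
    · exact (hYd i j fun h => hij (by rw [h])).mono (hY'Y i) (hY'Y j)
    · exact hYZ i j
    · exact (hYZ j i).symm
    · exact hZd i j fun h => hij (by rw [h])
  · refine (Nat.le_ceil c).trans (Nat.cast_le.2 (le_of_eq ?_))
    refine Fin.addCases (fun i => ?_) (fun i => ?_) i <;>
      simp [hY'c, hZc]
  · refine convexHull_mono ?_ (hY (fun j => y (Fin.castAdd r j)) fun j => hY'Y j ?_)
    · rintro _ ⟨j, rfl⟩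
      exact ⟨Fin.castAdd r j, rfl⟩
    · simpa using hy (Fin.castAdd r j)

theorem tukeyCount_le {d n : ℕ} (hd : 1 ≤ d) (x : Fin n → EuclideanSpace ℝ (Fin d))
    (q w : EuclideanSpace ℝ (Fin d)) :
    tukeyCount x q ≤ {i ∈ (Finset.univ : Finset (Fin n)) | inner ℝ w (x i - q) ≤ 0}.card := by
  classical
  have key : ∀ w : EuclideanSpace ℝ (Fin d), w ≠ 0 →
      tukeyCount x q ≤ {i ∈ (Finset.univ : Finset (Fin n)) | inner ℝ w (x i - q) ≤ 0}.card := by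
    intro w hw
    refine Nat.sInf_le ⟨w, inner ℝ w q, hw, le_rfl, ?_⟩
    rw [pointsInHalfspace]
    congr 1
    ext i
    simp [inner_sub_right]
  by_cases hw : w = 0
  · have : Nontrivial (EuclideanSpace ℝ (Fin d)) :=
      (Module.finrank_pos_iff (R := ℝ)).1 (by rw [finrank_euclideanSpace_fin]; omega)
    obtain ⟨w₀, hw₀⟩ := exists_ne (0 : EuclideanSpace ℝ (Fin d))
    refine (key w₀ hw₀).trans (Finset.card_le_card fun i _ => ?_)
    simp [hw]
  · exact key w hw

theorem isDepthCaratheodoryConstant {d : ℕ} (hd : 1 ≤ d) :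
    IsDepthCaratheodoryConstant d (depthConstant d) := by
  refine ⟨fun t ht _ => depthConstant_pos d ht, fun n x q hn hτ => ?_⟩
  set τ := tukeyDepth x q with hτ_def
  have hn0 : 0 < n := by omega
  have hnR : (0 : ℝ) < n := by exact_mod_cast hn0
  have hτn : τ * n = tukeyCount x q := by
    rw [hτ_def, tukeyDepth, div_mul_cancel₀ _ hnR.ne']
  have hfin : finrank ℝ (EuclideanSpace ℝ (Fin d)) = d := finrank_euclideanSpace_fin
  have hdeep := hasDeepTransversals_depthRate (x := fun i => x i - q) (A := Finset.univ) hτ hn0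
    (by simp) fun w => by
      rw [hτn]
      exact_mod_cast tukeyCount_le hd x q w
  rw [hfin] at hdeep
  set c := depthConstant d τ with hc
  have hcpos : 0 < c := depthConstant_pos d hτ
  have hcdef : c = _ := if_pos hτ
  have hc1 : c ≤ depthRate d τ := hcdef.trans_le ((min_le_left _ _).trans (min_le_left _ _))
  have hc2 : c ≤ 1 / (2 * (d + 1)) := hcdef.trans_le ((min_le_right _ _).trans (min_le_right _ _))
  have hceil : (d + 1) * ⌈c * n⌉₊ ≤ n := by
    rcases le_or_gt (c * n) 1 with h | h
    · have : ⌈c * n⌉₊ ≤ 1 := Nat.ceil_le.2 (by simpa using h)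
      nlinarith
    · have h1 := Nat.ceil_lt_add_one (show 0 ≤ c * n by positivity)
      have h2 : c * n ≤ n / (2 * (d + 1)) := by
        calc c * n ≤ 1 / (2 * (d + 1)) * n := by gcongr
          _ = _ := by ring
      have h3 : ((d : ℝ) + 1) * ⌈c * n⌉₊ ≤ n := by
        have h4 : (⌈c * n⌉₊ : ℝ) ≤ n / (d + 1) := by
          have : (n : ℝ) / (d + 1) = 2 * (n / (2 * (d + 1))) := by field_simp
          linarith
        rwa [le_div_iff₀ (by positivity), mul_comm] at h4
      exact_mod_cast h3
  obtain ⟨X, hXd, hXc, hX⟩ := (hdeep.mono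
    (mul_le_mul_of_nonneg_right hc1 hnR.le)).exists_fin (D := d + 1) (by rw [hfin]) hceil
  refine ⟨X, hXd, hXc, fun y hy => ?_⟩
  have h0 := Set.mem_image_of_mem
    (AffineEquiv.constVAdd ℝ (EuclideanSpace ℝ (Fin d)) q).toAffineMap (hX y hy)
  rw [AffineMap.image_convexHull, ← Set.range_comp] at h0
  simpa [Function.comp_def] using h0

end Constants

/-! ### A deep point for a family of convex sets -/

section DeepPoint

open Module (finrank)
open Metric (infDist)

variable {E ι : Type*} [NormedAddCommGroup E] [InnerProductSpace ℝ E]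

open Classical in
/-- The number of sets of the family that miss a point stays large if only the sets at a certain
positive distance are counted. -/
theorem exists_radius [FiniteDimensional ℝ E] {C : ι → Set E} {I : Finset ι}
    (hcomp : ∀ i ∈ I, IsCompact (C i)) (hne : ∀ i ∈ I, (C i).Nonempty) {a : ℝ} (ha : ∀ p, a < {i ∈ I | p ∉ C i}.card) :
    ∃ r > (0 : ℝ), ∀ p, a < {i ∈ I | r ≤ infDist p (C i)}.card := by
  have hbdd : Bornology.IsBounded (⋃ i ∈ I, C i) :=
    (Bornology.isBounded_biUnion_finset I).2 fun i hi => (hcomp i hi).isBounded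
  obtain ⟨ρ, hρ⟩ := hbdd.subset_closedBall (0 : E)
  obtain ⟨r, hr, hball⟩ : ∃ r > (0 : ℝ), ∀ p ∈ Metric.closedBall (0 : E) (ρ + 1),
      a < {i ∈ I | r ≤ infDist p (C i)}.card := by
    refine (isCompact_closedBall (0 : E) (ρ + 1)).induction_on
      (p := fun s => ∃ r > (0 : ℝ), ∀ p ∈ s, a < {i ∈ I | r ≤ infDist p (C i)}.card)
      ⟨1, one_pos, by simp⟩ ?_ ?_ ?_
    · rintro s t hst ⟨r, hr, h⟩
      exact ⟨r, hr, fun p hp => h p (hst hp)⟩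
    · rintro s t ⟨r, hr, h⟩ ⟨r', hr', h'⟩
      refine ⟨min r r', lt_min hr hr', fun p hp => ?_⟩
      rcases hp with hp | hp
      · refine (h p hp).trans_le (Nat.cast_le.2 (Finset.card_le_card ?_))
        exact Finset.monotone_filter_right I fun i _ hi => (min_le_left _ _).trans hi
      · refine (h' p hp).trans_le (Nat.cast_le.2 (Finset.card_le_card ?_))
        exact Finset.monotone_filter_right I fun i _ hi => (min_le_right _ _).trans hi
    · intro p _
      obtain ⟨r, hrp, hr⟩ : ∃ r : ℝ, (∀ i ∈ {i ∈ I | p ∉ C i}, r < infDist p (C i)) ∧ 0 < r := by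
        have hev : ∀ᶠ r : ℝ in nhdsWithin 0 (Set.Ioi 0),
            ∀ i ∈ {i ∈ I | p ∉ C i}, r < infDist p (C i) := by
          refine (Filter.eventually_all_finset _).2 fun i hi => ?_
          rw [Finset.mem_filter] at hi
          have hpos : 0 < infDist p (C i) :=
            ((hcomp i hi.1).isClosed.notMem_iff_infDist_pos (hne i hi.1)).1 hi.2
          exact nhdsWithin_le_nhds (Iio_mem_nhds hpos)
        exact (hev.and self_mem_nhdsWithin).exists
      have hev : ∀ᶠ p' in nhds p, ∀ i ∈ {i ∈ I | p ∉ C i}, r < infDist p' (C i) := by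
        refine (Filter.eventually_all_finset _).2 fun i hi => ?_
        exact continuousAt_const.eventually_lt (Metric.continuous_infDist_pt (C i)).continuousAt
          (hrp i hi)
      refine ⟨_, nhdsWithin_le_nhds hev, r, hr, fun p' hp' => ?_⟩
      refine (ha p).trans_le (Nat.cast_le.2 (Finset.card_le_card fun i hi => ?_))
      exact Finset.mem_filter.2 ⟨(Finset.mem_filter.1 hi).1, (hp' i hi).le⟩
  refine ⟨min r 1, lt_min hr one_pos, fun p => ?_⟩
  by_cases hp : p ∈ Metric.closedBall (0 : E) (ρ + 1)
  · refine (hball p hp).trans_le (Nat.cast_le.2 (Finset.card_le_card ?_))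
    exact Finset.monotone_filter_right I fun i _ hi => (min_le_left _ _).trans hi
  · refine (ha p).trans_le (Nat.cast_le.2 (Finset.card_le_card fun i hi => ?_))
    rw [Finset.mem_filter] at hi ⊢
    refine ⟨hi.1, (min_le_right _ _).trans ((Metric.le_infDist (hne i hi.1)).2 fun c hc => ?_)⟩
    have h1 : dist c 0 ≤ ρ := hρ (Set.mem_biUnion hi.1 hc)
    have h2 : ρ + 1 < dist p 0 := not_le.1 hp
    linarith [dist_triangle p c 0]

open Classical in
/-- Let every point be missed by many of the compact convex sets `C i`. Then there is a point `p`
such that every move away from `p` fails to bring `p` closer to many of the sets that miss it. -/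
theorem exists_deep_point [FiniteDimensional ℝ E] {C : ι → Set E} {I : Finset ι}
    (hconv : ∀ i ∈ I, Convex ℝ (C i))
    (hcomp : ∀ i ∈ I, IsCompact (C i)) (hne : ∀ i ∈ I, (C i).Nonempty) {a b : ℝ} (hb : 0 < b)
    (hab : (finrank ℝ E + 1) * b ≤ a) (ha : ∀ p, a < {i ∈ I | p ∉ C i}.card) :
    ∃ p, ∀ y, b ≤ {i ∈ I | p ∉ C i ∧ infDist p (C i) ≤ infDist y (C i)}.card := by
  obtain ⟨r, hr, hra⟩ := exists_radius hcomp hne ha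
  set G : E → Set E := fun y =>
    {p | b ≤ {i ∈ I | r ≤ infDist p (C i) ∧ infDist p (C i) ≤ infDist y (C i)}.card} with hG
  have hclosed : ∀ y, IsClosed (G y) := by
    intro y
    have hGy : G y = ⋃ B ∈ I.powerset.filter fun B => b ≤ B.card,
        ⋂ i ∈ B, {p | r ≤ infDist p (C i) ∧ infDist p (C i) ≤ infDist y (C i)} := by
      ext p
      simp only [Set.mem_iUnion, Set.mem_iInter, Finset.mem_filter, Finset.mem_powerset, hG]
      constructor
      · intro hp
        exact ⟨_, ⟨Finset.filter_subset _ _, hp⟩, fun i hi => (Finset.mem_filter.1 hi).2⟩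
      · rintro ⟨B, ⟨hBI, hB⟩, h⟩
        refine hB.trans (Nat.cast_le.2 (Finset.card_le_card fun i hi => ?_))
        exact Finset.mem_filter.2 ⟨hBI hi, h i hi⟩
    rw [hGy]
    refine isClosed_biUnion_finset fun B _ => isClosed_biInter fun i _ => ?_
    exact (isClosed_le continuous_const (Metric.continuous_infDist_pt _)).inter
      (isClosed_le (Metric.continuous_infDist_pt _) continuous_const)
  have hcompact : IsCompact (G 0) := by
    have hbdd : Bornology.IsBounded (⋃ i ∈ I, C i) :=
      (Bornology.isBounded_biUnion_finset I).2 fun i hi => (hcomp i hi).isBounded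
    obtain ⟨ρ, hρ⟩ := hbdd.subset_closedBall (0 : E)
    refine (isCompact_closedBall (0 : E) (ρ + ρ)).of_isClosed_subset (hclosed 0) fun p hp => ?_
    have hcard : 0 < {i ∈ I | r ≤ infDist p (C i) ∧ infDist p (C i) ≤ infDist 0 (C i)}.card := by
      have : b ≤ _ := hp
      exact_mod_cast hb.trans_le this
    obtain ⟨i, hi⟩ := Finset.card_pos.1 hcard
    rw [Finset.mem_filter] at hi
    obtain ⟨c, hc⟩ := hne i hi.1
    have hball : ∀ c ∈ C i, dist c 0 ≤ ρ := fun c hc => hρ (Set.mem_biUnion hi.1 hc)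
    have h1 : infDist 0 (C i) ≤ ρ := (Metric.infDist_le_dist_of_mem hc).trans
      (by rw [dist_comm]; exact hball c hc)
    have h2 : dist p 0 - ρ ≤ infDist p (C i) := (Metric.le_infDist ⟨c, hc⟩).2 fun c' hc' => by
      linarith [dist_triangle p c' 0, hball c' hc']
    rw [Metric.mem_closedBall]
    linarith [hi.2.2]
  obtain ⟨p, hp⟩ := nonempty_iInter_of_convexHull_subset G hclosed 0 hcompact (by
    intro s p hp
    rw [← Set.image_id (s : Set E)] at hp
    obtain ⟨S, hSs, hSc, hS⟩ := exists_subset_card_le_mem_convexHull hp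
    by_contra! hcon
    -- Some set gets closer to all the points of `S` at once, against convexity.
    obtain ⟨i, hi, hiS⟩ : ∃ i ∈ {i ∈ I | r ≤ infDist p (C i)},
        ∀ y ∈ S, infDist y (C i) < infDist p (C i) := by
      by_contra! hno
      have hsub : {i ∈ I | r ≤ infDist p (C i)} ⊆ S.biUnion fun y =>
          {i ∈ I | r ≤ infDist p (C i) ∧ infDist p (C i) ≤ infDist y (C i)} := by
        intro i hi
        obtain ⟨y, hy, hiy⟩ := hno i hi
        rw [Finset.mem_filter] at hi
        exact Finset.mem_biUnion.2 ⟨y, hy, Finset.mem_filter.2 ⟨hi.1, hi.2, hiy⟩⟩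
      have h1 : (({i ∈ I | r ≤ infDist p (C i)}.card : ℕ) : ℝ) ≤ ∑ y ∈ S,
          ({i ∈ I | r ≤ infDist p (C i) ∧ infDist p (C i) ≤ infDist y (C i)}.card : ℝ) := by
        exact_mod_cast (Finset.card_le_card hsub).trans Finset.card_biUnion_le
      have h2 := Finset.sum_le_card_nsmul S (fun y =>
        ({i ∈ I | r ≤ infDist p (C i) ∧ infDist p (C i) ≤ infDist y (C i)}.card : ℝ)) b
        fun y hy => (not_le.1 (hcon y (hSs hy))).le
      have h3 : (S.card : ℝ) * b ≤ (finrank ℝ E + 1) * b := by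
        gcongr
        exact_mod_cast hSc
      rw [nsmul_eq_mul] at h2
      linarith [hra p]
    rw [Finset.mem_filter] at hi
    have hsub : convexHull ℝ (id '' (S : Set E)) ⊆ Metric.thickening (infDist p (C i)) (C i) := by
      refine convexHull_min ?_ ((hconv i hi.1).thickening _)
      rintro _ ⟨y, hy, rfl⟩
      exact (Metric.mem_thickening_iff_infDist_lt (hne i hi.1)).2 (hiS y hy)
    exact lt_irrefl _ ((Metric.mem_thickening_iff_infDist_lt (hne i hi.1)).1 (hsub hS)))
  refine ⟨p, fun y => ?_⟩
  have hpy : b ≤ _ := Set.mem_iInter.1 hp y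
  refine hpy.trans (Nat.cast_le.2 (Finset.card_le_card
    (Finset.monotone_filter_right I fun i hi h => ⟨?_, h.2⟩)))
  intro hmem
  rw [Metric.infDist_zero_of_mem hmem] at h
  exact hr.not_ge h.1

/-- The nearest point of a closed convex set gives a separating hyperplane. -/
theorem exists_nearest_point {K : Set E} (hK : Convex ℝ K) (hcomp : IsCompact K) (hne : K.Nonempty)
    (p : E) : ∃ c ∈ K, infDist p K = dist p c ∧ ∀ y ∈ K, p ∉ K → 0 < inner ℝ (c - p) (y - p) := by
  obtain ⟨c, hc, hcp⟩ := hcomp.exists_infDist_eq_dist hne p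
  refine ⟨c, hc, hcp, fun y hy hp => ?_⟩
  have hproj : ‖p - c‖ = ⨅ w : K, ‖p - w‖ := by
    rw [← dist_eq_norm, ← hcp, Metric.infDist_eq_iInf]
    simp [dist_eq_norm]
  have h1 := (norm_eq_iInf_iff_real_inner_le_zero hK hc).1 hproj y hy
  have h2 : 0 < inner ℝ (c - p) (c - p) := by
    rw [real_inner_self_eq_norm_sq]
    have : c - p ≠ 0 := sub_ne_zero.2 fun h => hp (h ▸ hc)
    positivity
  have h3 : inner ℝ (c - p) (y - p) = inner ℝ (c - p) (c - p) - inner ℝ (p - c) (y - c) := by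
    simp only [inner_sub_left, inner_sub_right]
    ring
  linarith

open Classical in
/-- At a point as in `exists_deep_point`, `0` is deep with respect to the directions to the nearest
points of the sets. -/
theorem le_card_inner_nonpos {C : ι → Set E} {I : Finset ι} {p : E} {b : ℝ} {c : ι → E}
    (hc : ∀ i ∈ I, c i ∈ C i ∧ infDist p (C i) = dist p (c i))
    (hp : ∀ y, b ≤ {i ∈ I | p ∉ C i ∧ infDist p (C i) ≤ infDist y (C i)}.card) (w : E) :
    b ≤ {i ∈ {i ∈ I | p ∉ C i} | inner ℝ w (c i - p) ≤ 0}.card := by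
  have hev : ∀ᶠ ε : ℝ in nhdsWithin 0 (Set.Ioi 0), ∀ i ∈ {i ∈ I | 0 < inner ℝ w (c i - p)},
      infDist (p + ε • w) (C i) < infDist p (C i) := by
    refine (Filter.eventually_all_finset _).2 fun i hi => ?_
    rw [Finset.mem_filter] at hi
    have hsmall : ∀ᶠ ε : ℝ in nhds 0, ε * ‖w‖ ^ 2 < 2 * inner ℝ w (c i - p) := by
      have hcont : Continuous fun ε : ℝ => ε * ‖w‖ ^ 2 := by fun_prop
      refine hcont.continuousAt.eventually_lt continuousAt_const ?_
      simpa using hi.2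
    filter_upwards [nhdsWithin_le_nhds hsmall, self_mem_nhdsWithin] with ε hε hε0
    have hε0' : 0 < ε := hε0
    rw [(hc i hi.1).2]
    refine (Metric.infDist_le_dist_of_mem (hc i hi.1).1).trans_lt ?_
    rw [dist_eq_norm, dist_eq_norm, ← sq_lt_sq₀ (norm_nonneg _) (norm_nonneg _)]
    have h1 : p + ε • w - c i = (p - c i) + ε • w := by abel
    rw [h1, norm_add_sq_real, norm_smul, real_inner_smul_right, mul_pow, Real.norm_eq_abs, sq_abs,
      ← neg_sub (c i) p, inner_neg_left, real_inner_comm]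
    nlinarith [mul_lt_mul_of_pos_left hε hε0']
  obtain ⟨ε, hε⟩ := hev.exists
  refine (hp (p + ε • w)).trans (Nat.cast_le.2 (Finset.card_le_card fun i hi => ?_))
  rw [Finset.mem_filter] at hi
  refine Finset.mem_filter.2 ⟨Finset.mem_filter.2 ⟨hi.1, hi.2.1⟩, ?_⟩
  by_contra! hpos
  exact (hε i (Finset.mem_filter.2 ⟨hi.1, hpos⟩)).not_ge hi.2.2

end DeepPoint

/-! ### Families of convex sets with many intersecting transversals -/

section Helly

variable {d n : ℕ}

/-- If every `d + 1` sets of the family meet, Helly's theorem applies. -/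
theorem nonempty_iInter_of_forall_transversal {C : Fin n → Set (EuclideanSpace ℝ (Fin d))}
    (hn : d + 1 ≤ n) (hC : ∀ i, Convex ℝ (C i))
    (h : ∀ D : Fin (d + 1) → Fin n, (⋂ i, C (D i)).Nonempty) : (⋂ i, C i).Nonempty := by
  have hhelly := Convex.helly_theorem (𝕜 := ℝ) (F := C) (s := Finset.univ)
    (by simpa using hn) (fun i _ => hC i) (by
      intro I _ hI
      rw [finrank_euclideanSpace_fin] at hI
      obtain ⟨z, hz⟩ := h fun j => (I.equivFinOfCardEq hI).symm j
      refine ⟨z, Set.mem_iInter₂.2 fun i hi => ?_⟩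
      have := Set.mem_iInter.1 hz (I.equivFinOfCardEq hI ⟨i, hi⟩)
      simpa using this)
  simpa using hhelly

open Classical in
/-- Compact convex sets that contain, for each intersecting transversal `D`, a point common to all
the sets of `D`. -/
theorem exists_compact_convex_subsets {C : Fin n → Set (EuclideanSpace ℝ (Fin d))}
    (hC : ∀ i, Convex ℝ (C i)) :
    ∃ K : Fin n → Set (EuclideanSpace ℝ (Fin d)), (∀ i, Convex ℝ (K i)) ∧
      (∀ i, IsCompact (K i)) ∧ (∀ i, K i ⊆ C i) ∧
      ∀ D : Fin (d + 1) → Fin n, (⋂ i, C (D i)).Nonempty → (⋂ i, K (D i)).Nonempty := by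
  have hpt : ∀ D : Fin (d + 1) → Fin n, ∃ z, (⋂ i, C (D i)).Nonempty → ∀ i, z ∈ C (D i) := by
    intro D
    by_cases h : (⋂ i, C (D i)).Nonempty
    · exact ⟨h.some, fun _ i => Set.mem_iInter.1 h.some_mem i⟩
    · exact ⟨0, fun h' => absurd h' h⟩
  choose pt hpt using hpt
  refine ⟨fun i => convexHull ℝ (pt '' {D | (⋂ j, C (D j)).Nonempty ∧ ∃ j, D j = i}),
    fun i => convex_convexHull ℝ _, fun i => (Set.toFinite _).isCompact_convexHull (𝕜 := ℝ), fun i => ?_,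
    fun D hD => ⟨pt D, Set.mem_iInter.2 fun i => ?_⟩⟩
  · refine convexHull_min ?_ (hC i)
    rintro _ ⟨D, ⟨hD, j, rfl⟩, rfl⟩
    exact hpt D hD j
  · exact subset_convexHull ℝ _ ⟨D, ⟨hD, i, rfl⟩, rfl⟩

open Classical in
/-- The Helly type theorem for compact sets. If no point were in `(1 - δ) n` of the sets, then a
deep point for the nonempty ones would give large subfamilies without an intersecting
transversal. -/
theorem exists_point_mem_of_transversals {K : Fin n → Set (EuclideanSpace ℝ (Fin d))}
    {δ : ℝ} (hδ : 0 < δ) (hn : 0 < n) (hconv : ∀ i, Convex ℝ (K i))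
    (hcomp : ∀ i, IsCompact (K i))
    (h : ∀ F : Fin (d + 1) → Finset (Fin n),
      (∀ i, (F i).Nonempty ∧ depthConstant d δ * n ≤ ((F i).card : ℝ)) →
      ∃ D : Fin (d + 1) → Fin n, (∀ i, D i ∈ F i) ∧ (⋂ i, K (D i)).Nonempty) :
    ∃ p, (1 - δ) * n ≤ (Finset.univ.filter fun i => p ∈ K i).card := by
  by_contra! hcon
  have hnR : (0 : ℝ) < n := by exact_mod_cast hn
  have hfin : Module.finrank ℝ (EuclideanSpace ℝ (Fin d)) = d := finrank_euclideanSpace_fin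
  set c := depthConstant d δ with hc_def
  have hc0 : 0 < c := depthConstant_pos d hδ
  have hc : c = _ := if_pos hδ
  set τ := δ / (2 * (d + 1)) with hτ_def
  have hτ : 0 < τ := by positivity
  have hc1 : c ≤ depthRate d τ := hc.trans_le ((min_le_left _ _).trans (min_le_right _ _))
  have hc2 : c ≤ δ / 2 := hc.trans_le ((min_le_right _ _).trans (min_le_left _ _))
  have hF : ∀ s : Finset (Fin n), c * n ≤ s.card → s.Nonempty := by
    intro s hs
    rw [← Finset.card_pos]
    exact_mod_cast (mul_pos hc0 hnR).trans_le hs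
  set I := Finset.univ.filter fun i => (K i).Nonempty with hI
  have hmemI : ∀ {i}, i ∈ I ↔ (K i).Nonempty := by simp [hI]
  -- The empty sets form too small a subfamily to matter.
  have hempty : ((Iᶜ).card : ℝ) < c * n := by
    by_contra! hge
    obtain ⟨D, hD, z, hz⟩ := h (fun _ => Iᶜ) fun _ => ⟨hF _ hge, hge⟩
    exact Finset.mem_compl.1 (hD 0) (hmemI.2 ⟨z, Set.mem_iInter.1 hz 0⟩)
  have hmiss : ∀ p, δ / 2 * n < {i ∈ I | p ∉ K i}.card := by
    intro p
    have hcover : (Finset.univ : Finset (Fin n)) ⊆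
        {i ∈ I | p ∉ K i} ∪ (Iᶜ ∪ Finset.univ.filter fun i => p ∈ K i) := by
      intro i _
      by_cases h1 : i ∈ I <;> by_cases h2 : p ∈ K i <;> simp [h1, h2]
    have h1 := (Finset.card_le_card hcover).trans ((Finset.card_union_le _ _).trans
      (Nat.add_le_add_left (Finset.card_union_le _ _) _))
    rw [Finset.card_univ, Fintype.card_fin] at h1
    have h2 : (n : ℝ) ≤ {i ∈ I | p ∉ K i}.card +
        ((Iᶜ).card + (Finset.univ.filter fun i => p ∈ K i).card) := by exact_mod_cast h1
    have h3 := mul_le_mul_of_nonneg_right hc2 hnR.le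
    linarith [hcon p]
  obtain ⟨p, hp⟩ := exists_deep_point (C := K) (I := I) (b := τ * n) (fun i _ => hconv i)
    (fun i _ => hcomp i) (fun i hi => hmemI.1 hi) (by positivity)
    (by rw [hfin, hτ_def]; field_simp; exact le_rfl) hmiss
  have hnear : ∀ i, ∃ c, i ∈ I → c ∈ K i ∧ Metric.infDist p (K i) = dist p c ∧
      ∀ y ∈ K i, p ∉ K i → 0 < inner ℝ (c - p) (y - p) := by
    intro i
    by_cases hi : i ∈ I
    · obtain ⟨c, h⟩ := exists_nearest_point (hconv i) (hcomp i) (hmemI.1 hi) p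
      exact ⟨c, fun _ => h⟩
    · exact ⟨0, fun h => absurd h hi⟩
  choose v hv using hnear
  have hdeep := hasDeepTransversals_depthRate (x := fun i => v i - p) (A := {i ∈ I | p ∉ K i})
    hτ hn ((Finset.card_le_univ _).trans (by simp))
    (le_card_inner_nonpos (fun i hi => ⟨(hv i hi).1, (hv i hi).2.1⟩) hp)
  rw [hfin] at hdeep
  obtain ⟨m, hm, Y, hYA, -, hYc, hY⟩ := hdeep.mono (mul_le_mul_of_nonneg_right hc1 hnR.le)
  rw [hfin] at hm
  have hm0 : 0 < m := by
    by_contra hm0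
    obtain rfl : m = 0 := by omega
    simpa using hY (fun j => j.elim0) fun j => j.elim0
  obtain ⟨D, hD, z, hz⟩ := h (fun j => if hj : (j : ℕ) < m then Y ⟨j, hj⟩ else Y ⟨0, hm0⟩) (by
    intro j
    have hj : c * n ≤ (if hj : (j : ℕ) < m then Y ⟨j, hj⟩ else Y ⟨0, hm0⟩).card := by
      split_ifs
      exacts [hYc _, hYc _]
    exact ⟨hF _ hj, hj⟩)
  have hDY : ∀ j : Fin m, D (Fin.castLE hm j) ∈ Y j := by
    intro j
    simpa using hD (Fin.castLE hm j)
  -- All the directions chosen make an acute angle with `z - p`.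
  have hsub : convexHull ℝ (Set.range fun j : Fin m => v (D (Fin.castLE hm j)) - p) ⊆
      {u | 0 < inner ℝ (z - p) u} := by
    refine convexHull_min ?_ (convex_inner_pos _)
    rintro _ ⟨j, rfl⟩
    obtain ⟨hI, hpK⟩ := Finset.mem_filter.1 (hYA j (hDY j))
    have := (hv _ hI).2.2 z (Set.mem_iInter.1 hz _) hpK
    rwa [real_inner_comm] at this
  have := hsub (hY (fun j => D (Fin.castLE hm j)) hDY)
  simp at this

end Helly

theorem theorem7 :
    ∃ c : ℕ → ℝ → ℝ,
      (∀ d : ℕ, 1 ≤ d → IsDepthCaratheodoryConstant d (c d)) ∧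
      (∀ d : ℕ, c d 0 = 0) ∧
      ∀ (d : ℕ) (β : ℝ), 1 ≤ d → 0 ≤ β → β ≤ 1 →
        ∀ (n : ℕ) (C : Fin n → Set (EuclideanSpace ℝ (Fin d))),
          d + 1 ≤ n → (∀ i, Convex ℝ (C i)) →
          (∀ F : Fin (d + 1) → Finset (Fin n),
            (∀ i, (F i).Nonempty ∧ c d (1 - β) * n ≤ ((F i).card : ℝ)) →
            ∃ D : Fin (d + 1) → Fin n, (∀ i, D i ∈ F i) ∧ (⋂ i, C (D i)).Nonempty) →
          ∃ F' : Finset (Fin n), β * n ≤ (F'.card : ℝ) ∧ (⋂ i ∈ F', C i).Nonempty := by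
  have hzero : ∀ d, depthConstant d 0 = 0 := fun d => if_neg (lt_irrefl 0)
  refine ⟨depthConstant, fun d hd => isDepthCaratheodoryConstant hd, hzero, ?_⟩
  intro d β hd hβ0 hβ1 n C hn hC h
  classical
  rcases hβ1.eq_or_lt with rfl | hβ
  · rw [sub_self, hzero] at h
    refine ⟨Finset.univ, by simp, ?_⟩
    simpa using nonempty_iInter_of_forall_transversal hn hC fun D => by
      obtain ⟨D', hD', hne⟩ := h (fun i => {D i}) fun i => by simp
      obtain rfl : D' = D := funext fun i => Finset.mem_singleton.1 (hD' i)
      exact hne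
  · obtain ⟨K, hKconv, hKcomp, hKC, hK⟩ := exists_compact_convex_subsets hC
    obtain ⟨p, hp⟩ := exists_point_mem_of_transversals (sub_pos.2 hβ) (by omega) hKconv hKcomp
      fun F hF => by
        obtain ⟨D, hD, hne⟩ := h F hF
        exact ⟨D, hD, hK D hne⟩
    rw [sub_sub_cancel] at hp
    exact ⟨_, hp, p, Set.mem_iInter₂.2 fun i hi => hKC i (Finset.mem_filter.1 hi).2⟩
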